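/- Let $F_2=\langle x,y\rangle$ be the free group on $x,y$ and $G=\mathrm{Aut}(F_2)$. Let $\mathrm{Inn}(F_2)$ be the group of inner automorphisms, and let $\mathrm{Aut}'(F_2)\le G$ be the preimage of $\left\langle \begin{pmatrix}1&2\\0&1\end{pmatrix},\begin{pmatrix}1&0\\2&1\end{pmatrix}\right\rangle$ under the natural map $G\to \mathrm{Aut}(F_2/F_2')=GL_2(\mathbb Z)$. Let $\alpha,\beta\in G$ be given by $\alpha(x)=x,\ \alpha(y)=yx^2$ and $\beta(x)=xy^2,\ \beta(y)=y$. For a normal subgroup $M$ of $F_2$ put $$G(M)=\{\sigma\in G : \sigma(M)=M \text{ and } \sigma \text{ acts trivially on } F_2/M\}.$$ For a subgroup $L\le F_2$ and $m\ge 1$ let $L'L^m$ denote the subgroup generated by the commutators and the $m$-th powers of elements of $L$. Let $\Delta=\ker(F_2\to(\mathbb Z/2\mathbb Z)^2)$, where $x\mapsto(1,0)$ and $y\mapsto(0,1)$. It is freely generated by $e_1=x^2,\ e_2=yxy^{-1}x^{-1},\ e_3=y^2,\ e_4=xyxy^{-1},\ e_5=xy^2x^{-1}$. Let $\pi:\Delta\to\langle\alpha,\beta\rangle$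 be the homomorphism with $e_1\mapsto\alpha,\ e_2\mapsto 1,\ e_3\mapsto\beta,\ e_4\mapsto\alpha^{-1},\ e_5\mapsto\beta^{-1}$. **Theorem.** Let $H$ be a finite index normal subgroup of $G=\mathrm{Aut}(F_2)$ with $\mathrm{Inn}(F_2)\le H\le \mathrm{Aut}'(F_2)$, and let $n=[\mathrm{Aut}'(F_2):H]$. Let $p$ be a prime with $p\nmid 6n$. Put $K=H\cap\langle\alpha,\beta\rangle$ and $$N=F_2'F_2^6\cap\bigcap_{g\in F_2}g^{-1}\pi^{-1}(K)g,\qquad M=F_2'F_2^4\cap N'N^p .$$ Then $M$ is a normal subgroup of $F_2$, its index in $F_2$ divides $144\cdot n^4\cdot p^{36n^4+1}$, and $G(M)\le H$. -/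

import Mathlib

namespace FreeTwo

/-- The free group `F₂` on two letters. -/
abbrev F : Type := FreeGroup (Fin 2)

/-- The first free generator of `F₂`. -/
def x : F := FreeGroup.of 0

/-- The second free generator of `F₂`. -/
def y : F := FreeGroup.of 1

/-! ### The map from `Aut F₂` to `GL₂(ℤ)` -/

/-- The exponent sum of the `i`-th free generator, as a homomorphism from `F₂` to `ℤ`
(written multiplicatively). -/
def expHom (i : Fin 2) : F →* Multiplicative ℤ :=
  FreeGroup.lift fun j => Multiplicative.ofAdd (if j = i then 1 else 0)

/-- The exponent sum of the `i`-th free generator in the word `w`. -/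
def expSum (i : Fin 2) (w : F) : ℤ := (expHom i w).toAdd

theorem expSum_map (f : F →* F) (i : Fin 2) (w : F) :
    expSum i (f w) = ∑ j, expSum i (f (FreeGroup.of j)) * expSum j w := by
  induction w using FreeGroup.induction_on with
  | C1 => simp [expSum]
  | of k => simp [expSum, expHom]
  | inv_of k _ => simp [expSum, expHom]
  | mul a b ha hb =>
    have h (j : Fin 2) (u v : F) : expSum j (u * v) = expSum j u + expSum j v := by
      simp [expSum]
    rw [map_mul, h, ha, hb, ← Finset.sum_add_distrib]
    exact Finset.sum_congr rfl fun j _ => by rw [h]; ring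

/-- The matrix of the action of an automorphism on `F₂ / F₂' = ℤ²` (vectors being columns):
the `j`-th column holds the exponent sums of the image of the `j`-th generator. -/
def abMatrix : MulAut F →* Matrix (Fin 2) (Fin 2) ℤ where
  toFun σ := Matrix.of fun i j => expSum i (σ (FreeGroup.of j))
  map_one' := by
    ext i j
    simp [expSum, expHom, Matrix.one_apply, eq_comm]
  map_mul' σ τ := by
    ext i j
    simpa [Matrix.mul_apply] using expSum_map σ.toMonoidHom i (τ (FreeGroup.of j))

/-- The natural homomorphism `Aut F₂ → Aut (F₂ / F₂') = GL₂(ℤ)`. -/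
def toGL : MulAut F →* GL (Fin 2) ℤ := abMatrix.toHomUnits

/-- The matrix with rows `(1, 2)` and `(0, 1)`. -/
def matA : GL (Fin 2) ℤ where
  val := !![1, 2; 0, 1]
  inv := !![1, -2; 0, 1]
  val_inv := by decide
  inv_val := by decide

/-- The matrix with rows `(1, 0)` and `(2, 1)`. -/
def matB : GL (Fin 2) ℤ where
  val := !![1, 0; 2, 1]
  inv := !![1, 0; -2, 1]
  val_inv := by decide
  inv_val := by decide

/-- `Aut'(F₂)`: the preimage in `Aut F₂` of the subgroup of `GL₂(ℤ)` generated by the two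
matrices above. -/
def AutPrime : Subgroup (MulAut F) := (Subgroup.closure {matA, matB}).comap toGL

/-- `Inn(F₂)`. -/
def Inn : Subgroup (MulAut F) := (MulAut.conj : F →* MulAut F).range

/-! ### The automorphisms `α` and `β` -/

/-- The automorphism `α`, given by `x ↦ x` and `y ↦ y x²`. -/
def alpha : MulAut F :=
  MonoidHom.toMulEquiv (FreeGroup.lift ![x, y * x ^ 2]) (FreeGroup.lift ![x, y * (x ^ 2)⁻¹])
    (by ext i; fin_cases i <;> simp [x, y]) (by ext i; fin_cases i <;> simp [x, y])

/-- The automorphism `β`, given by `x ↦ x y²` and `y ↦ y`. -/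
def beta : MulAut F :=
  MonoidHom.toMulEquiv (FreeGroup.lift ![x * y ^ 2, y]) (FreeGroup.lift ![x * (y ^ 2)⁻¹, y])
    (by ext i; fin_cases i <;> simp [x, y]) (by ext i; fin_cases i <;> simp [x, y])

theorem alpha_x : alpha x = x := by simp [alpha, x]
theorem alpha_y : alpha y = y * x ^ 2 := by simp [alpha, x, y]
theorem beta_x : beta x = x * y ^ 2 := by simp [beta, x, y]
theorem beta_y : beta y = y := by simp [beta, y]

theorem toGL_alpha : toGL alpha = matA := by
  ext i j
  fin_cases i <;> fin_cases j <;>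
    simp [toGL, abMatrix, expSum, expHom, alpha, matA, x, y]

theorem toGL_beta : toGL beta = matB := by
  ext i j
  fin_cases i <;> fin_cases j <;>
    simp [toGL, abMatrix, expSum, expHom, beta, matB, x, y]

/-- The subgroup `⟨α, β⟩` of `Aut F₂`. -/
def A : Subgroup (MulAut F) := Subgroup.closure {alpha, beta}

/-- `α` as an element of `⟨α, β⟩`. -/
def a : A := ⟨alpha, Subgroup.subset_closure (by simp)⟩

/-- `β` as an element of `⟨α, β⟩`. -/
def b : A := ⟨beta, Subgroup.subset_closure (by simp)⟩

/-! ### The subgroup `Δ` and the map `π : Δ → ⟨α, β⟩` -/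

/-- The group `(ℤ/2ℤ)²`, written multiplicatively. -/
abbrev V4 : Type := Multiplicative (ZMod 2 × ZMod 2)

/-- Reduction of the exponent sums modulo `2`: `x ↦ (1, 0)`, `y ↦ (0, 1)`. -/
def modTwo : F →* V4 :=
  FreeGroup.lift ![Multiplicative.ofAdd (1, 0), Multiplicative.ofAdd (0, 1)]

/-- `Δ = ker (F₂ → (ℤ/2ℤ)²)`. -/
def Delta : Subgroup F := modTwo.ker

/-- `e₁ = x²`. -/
def e1 : Delta := ⟨x ^ 2, by simp [Delta, MonoidHom.mem_ker, modTwo, x]; decide⟩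
/-- `e₂ = y x y⁻¹ x⁻¹`. -/
def e2 : Delta := ⟨y * x * y⁻¹ * x⁻¹, by simp [Delta, MonoidHom.mem_ker, modTwo, x, y]⟩
/-- `e₃ = y²`. -/
def e3 : Delta := ⟨y ^ 2, by simp [Delta, MonoidHom.mem_ker, modTwo, y]; decide⟩
/-- `e₄ = x y x y⁻¹`. -/
def e4 : Delta := ⟨x * y * x * y⁻¹, by simp [Delta, MonoidHom.mem_ker, modTwo, x, y]; decide⟩
/-- `e₅ = x y² x⁻¹`. -/
def e5 : Delta := ⟨x * y ^ 2 * x⁻¹, by simp [Delta, MonoidHom.mem_ker, modTwo, x, y]; decide⟩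

/-- The homomorphism from `F₂` to the wreath product of `⟨α, β⟩` with `F₂ / Δ` through which `π`
is defined: the component at the coset of `t ∈ {1, x, y, xy}` of the image of a generator `s` is
the prescribed value of `π` at the Schreier generator `t s t'⁻¹`, with `t' ∈ {1, x, y, xy}` in
the coset of `t s`. -/
def wr : F →* RegularWreathProduct A V4 :=
  FreeGroup.lift
    ![⟨fun t => if t.toAdd = (1, 0) then a else if t.toAdd = (1, 1) then a⁻¹ else 1,
        Multiplicative.ofAdd (1, 0)⟩,
      ⟨fun t => if t.toAdd = (0, 1) then b else if t.toAdd = (1, 1) then b⁻¹ else 1,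
        Multiplicative.ofAdd (0, 1)⟩]

theorem wr_right (w : F) : (wr w).right = modTwo w := by
  have h : RegularWreathProduct.rightHom.comp wr = modTwo := by
    refine FreeGroup.ext_hom _ _ fun i => ?_
    fin_cases i <;> rfl
  exact DFunLike.congr_fun h w

/-- The homomorphism `π : Δ → ⟨α, β⟩` with `e₁ ↦ α`, `e₂ ↦ 1`, `e₃ ↦ β`, `e₄ ↦ α⁻¹`, `e₅ ↦ β⁻¹`.
These values, and the fact that they determine `π`, are proved below. -/
def piHom : Delta →* A where
  toFun d := (wr d).left 1
  map_one' := by simp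
  map_mul' d d' := by
    have h : (wr (d : F)).right = 1 := (wr_right _).trans d.2
    simp [RegularWreathProduct.mul_def, h]

theorem piHom_values :
    piHom e1 = a ∧ piHom e2 = 1 ∧ piHom e3 = b ∧ piHom e4 = a⁻¹ ∧ piHom e5 = b⁻¹ := by
  have h1 : (0 : ZMod 2 × ZMod 2) ≠ (1, 0) := by decide
  have h2 : (0 : ZMod 2 × ZMod 2) ≠ (0, 1) := by decide
  have h3 : (0 : ZMod 2 × ZMod 2) ≠ (1, 1) := by decide
  refine ⟨?_, ?_, ?_, ?_, ?_⟩
  · simp [piHom, e1, wr, x, pow_two, h1, h3]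
  · simp [piHom, e2, wr, x, y, h1, h2, h3]
  · simp [piHom, e3, wr, y, pow_two, h2, h3]
  · simp [piHom, e4, wr, x, y, h1, h3]
  · simp [piHom, e5, wr, x, y, pow_two, h1, h3]

/-- `e₁, …, e₅` generate `Δ`. -/
theorem closure_e : Subgroup.closure {e1, e2, e3, e4, e5} = (⊤ : Subgroup Delta) := by
  have key : ∀ G : Subgroup F, x ^ 2 ∈ G → y * x * y⁻¹ * x⁻¹ ∈ G → y ^ 2 ∈ G →
      x * y * x * y⁻¹ ∈ G → x * y ^ 2 * x⁻¹ ∈ G →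
      ∀ w : F, ∃ t ∈ ({1, x, y, x * y} : Set F), w * t⁻¹ ∈ G := by
    intro G h1 h2 h3 h4 h5 w
    have step (s u t : F) (ht : t ∈ ({1, x, y, x * y} : Set F)) (w : F) (hw : w * u⁻¹ ∈ G)
        (h : u * s * t⁻¹ ∈ G) : ∃ t ∈ ({1, x, y, x * y} : Set F), w * s * t⁻¹ ∈ G :=
      ⟨t, ht, by simpa [mul_assoc] using G.mul_mem hw h⟩
    have hx (w : F) (hw : ∃ t ∈ ({1, x, y, x * y} : Set F), w * t⁻¹ ∈ G) :
        ∃ t ∈ ({1, x, y, x * y} : Set F), w * x * t⁻¹ ∈ G := by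
      obtain ⟨t, rfl | rfl | rfl | rfl, hw⟩ := hw
      · exact step x 1 x (by simp) w hw (by simp)
      · exact step x x 1 (by simp) w hw (by simpa [pow_two] using h1)
      · exact step x y (x * y) (by simp) w hw (by simpa [mul_assoc] using h2)
      · exact step x (x * y) y (by simp) w hw (by simpa [mul_assoc] using h4)
    have hy (w : F) (hw : ∃ t ∈ ({1, x, y, x * y} : Set F), w * t⁻¹ ∈ G) :
        ∃ t ∈ ({1, x, y, x * y} : Set F), w * y * t⁻¹ ∈ G := by
      obtain ⟨t, rfl | rfl | rfl | rfl, hw⟩ := hw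
      · exact step y 1 y (by simp) w hw (by simp)
      · exact step y x (x * y) (by simp) w hw (by simp)
      · exact step y y 1 (by simp) w hw (by simpa [pow_two] using h3)
      · exact step y (x * y) x (by simp) w hw (by simpa [pow_two, mul_assoc] using h5)
    have hx' (w : F) (hw : ∃ t ∈ ({1, x, y, x * y} : Set F), w * t⁻¹ ∈ G) :
        ∃ t ∈ ({1, x, y, x * y} : Set F), w * x⁻¹ * t⁻¹ ∈ G := by
      obtain ⟨t, rfl | rfl | rfl | rfl, hw⟩ := hw
      · exact step x⁻¹ 1 x (by simp) w hw (by simpa [pow_two] using G.inv_mem h1)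
      · exact step x⁻¹ x 1 (by simp) w hw (by simp)
      · exact step x⁻¹ y (x * y) (by simp) w hw (by simpa [mul_assoc] using G.inv_mem h4)
      · exact step x⁻¹ (x * y) y (by simp) w hw (by simpa [mul_assoc] using G.inv_mem h2)
    have hy' (w : F) (hw : ∃ t ∈ ({1, x, y, x * y} : Set F), w * t⁻¹ ∈ G) :
        ∃ t ∈ ({1, x, y, x * y} : Set F), w * y⁻¹ * t⁻¹ ∈ G := by
      obtain ⟨t, rfl | rfl | rfl | rfl, hw⟩ := hw
      · exact step y⁻¹ 1 y (by simp) w hw (by simpa [pow_two] using G.inv_mem h3)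
      · exact step y⁻¹ x (x * y) (by simp) w hw
          (by simpa [pow_two, mul_assoc] using G.inv_mem h5)
      · exact step y⁻¹ y 1 (by simp) w hw (by simp)
      · exact step y⁻¹ (x * y) x (by simp) w hw (by simp)
    have all (v : F) : ∀ w : F, (∃ t ∈ ({1, x, y, x * y} : Set F), w * t⁻¹ ∈ G) →
        ∃ t ∈ ({1, x, y, x * y} : Set F), w * v * t⁻¹ ∈ G := by
      induction v using FreeGroup.induction_on with
      | C1 => simp
      | of k => fin_cases k; exacts [hx, hy]
      | inv_of k _ => fin_cases k; exacts [hx', hy']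
      | mul u v hu hv =>
        intro w hw
        rw [← mul_assoc]
        exact hv _ (hu _ hw)
    simpa using all w 1 ⟨1, by simp, by simp⟩
  rw [eq_top_iff]
  rintro ⟨w, hw⟩ -
  have mem (e : Delta) (he : e ∈ ({e1, e2, e3, e4, e5} : Set Delta)) :
      (e : F) ∈ (Subgroup.closure {e1, e2, e3, e4, e5}).map Delta.subtype :=
    ⟨e, Subgroup.subset_closure he, rfl⟩
  obtain ⟨t, ht, h⟩ := key _ (mem e1 (by simp)) (mem e2 (by simp)) (mem e3 (by simp))
    (mem e4 (by simp)) (mem e5 (by simp)) w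
  obtain ⟨d, hd, hdw⟩ := h
  have hdw' : (d : F) = w * t⁻¹ := hdw
  have h1 : modTwo t = 1 := by
    have hd1 : modTwo (d : F) = 1 := d.2
    have hw1 : modTwo w = 1 := hw
    rw [hdw', map_mul, hw1, one_mul, map_inv, inv_eq_one] at hd1
    exact hd1
  have ht1 : t = 1 := by
    rcases ht with rfl | rfl | rfl | rfl
    · rfl
    · exact absurd h1 (by simp [modTwo, x])
    · exact absurd h1 (by simp [modTwo, y])
    · exact absurd h1 (by simp [modTwo, x, y]; decide)
  rw [ht1, inv_one, mul_one] at hdw'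
  have : d = ⟨w, hw⟩ := Subtype.ext hdw'
  exact this ▸ hd

/-! ### Congruence subgroups and the subgroup `M` -/

/-- `G(M)`: the automorphisms `σ` of `F₂` with `σ(M) = M` that act trivially on `F₂ / M`. -/
def congr (M : Subgroup F) : Subgroup (MulAut F) where
  carrier := {σ | M.map σ.toMonoidHom = M ∧ ∀ g : F, ((σ g : F) : F ⧸ M) = (g : F ⧸ M)}
  one_mem' := ⟨Subgroup.map_id M, fun _ => rfl⟩
  mul_mem' := by
    rintro σ τ ⟨h1, h2⟩ ⟨h3, h4⟩
    refine ⟨?_, fun g => (h2 (τ g)).trans (h4 g)⟩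
    have : (σ * τ).toMonoidHom = σ.toMonoidHom.comp τ.toMonoidHom := rfl
    rw [this, ← Subgroup.map_map, h3, h1]
  inv_mem' := by
    rintro σ ⟨h1, h2⟩
    refine ⟨?_, fun g => ?_⟩
    · conv_lhs => rw [← h1, Subgroup.map_map]
      have : (σ⁻¹).toMonoidHom.comp σ.toMonoidHom = MonoidHom.id F := by
        ext i
        simp
      rw [this, Subgroup.map_id]
    · have := h2 (σ⁻¹ g)
      rw [MulAut.apply_inv_self] at this
      exact this.symm

/-- `N' Nᵐ`: the subgroup generated by the commutators and the `m`-th powers of elements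
of `N`. -/
def derivedPow (N : Subgroup F) (m : ℕ) : Subgroup F :=
  ⁅N, N⁆ ⊔ Subgroup.closure {g | ∃ h ∈ N, h ^ m = g}

/-- `π⁻¹(K)` as a subgroup of `F₂`, where `K = H ∩ ⟨α, β⟩`. -/
def preK (H : Subgroup (MulAut F)) : Subgroup F :=
  ((H.subgroupOf A).comap piHom).map Delta.subtype

/-- `N = F₂' F₂⁶ ∩ ⋂_{g ∈ F₂} g⁻¹ π⁻¹(K) g`. -/
def explicitN (H : Subgroup (MulAut F)) : Subgroup F :=
  derivedPow ⊤ 6 ⊓ (preK H).normalCore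

/-- `M = F₂' F₂⁴ ∩ N' Nᵖ`. -/
def explicitM (H : Subgroup (MulAut F)) (p : ℕ) : Subgroup F :=
  derivedPow ⊤ 4 ⊓ derivedPow (explicitN H) p

end FreeTwo

/-!
Write `Γ = F₂ / N`. Let `σ` fix `M` and act trivially on `F₂ / M`.

*Splitting off an inner automorphism.* Since `M ≤ F₂' F₂⁴`, the automorphism `σ` is congruent to
the identity modulo four, and such an automorphism is the product of the conjugation by some
`g ∈ F₂` and some `τ ∈ ⟨α, β⟩` (`exists_conj_mul_of_abMatrixMod_four`). This rests on Nielsen's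
theorem that the elementary transformations generate `Aut F₂` (`eq_top_of_nielsen_mem`), proved by
taking a basis of least total length: by Nielsen's cancellation argument it cannot shorten words,
so that it consists of letters. It follows that the group generated by `Inn(F₂)`, `α`, `β` and the
sign changes is normal with quotient a quotient of `S₃`, hence is the full congruence subgroup of
level two; modulo four the sign changes become visible.

*The conjugator.* Every `τ ∈ ⟨α, β⟩` fixes `c = [y, x]`, and `σ` is trivial modulo `N' Nᵖ`, so
`g` commutes with `c` modulo `N' Nᵖ`. Then `g ∈ ⟨c⟩ N`
(`mem_zpowers_of_commute_mod_derivedPow`). Indeed, derivations of `F₂` with values in the functions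
`Γ → ℤ/pℤ` vanish on `N' Nᵖ` and can be prescribed at `x` and `y`; summing over the cosets of
`⟨c⟩`, the Fox derivatives of the commutator relation say that the function
`1_⟨c⟩(g s) - 1_⟨c⟩(s)` of `s` is constant, and if `g ∉ ⟨c⟩ N` then it takes the values `1` and
`-1`, which differ as `p` is odd. Since `c = e₂` is in the kernel of `π` and `π(N) ≤ H`, it follows
that `π(g) ∈ H`.

*The element `τ`.* The map `π` is equivariant up to a twist: `π(τ d) = ι π(d) ι⁻¹`, where `ι` is
obtained from `τ` by `α ↦ α⁻¹`, `β ↦ β⁻¹` (`exists_piHom_actDelta`). Applying `π` to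
`σ(d) d⁻¹ ∈ N' Nᵖ` shows that `π(g) ι` is central modulo `R' Rᵖ`, where `R = π(N)`. The group
`⟨α, β⟩` is free on `α` and `β`, by ping-pong on the plane (`lift_matA_matB_injective`), and in the
free group of rank two, elements that are central modulo `R' Rᵖ` lie in `R`
(`mem_of_central_mod_derivedPow`, again by Fox derivatives). Hence `π(g) ι ∈ R ≤ H` and `ι ∈ H`.
Modulo `Inn(F₂)`, `ι` is the conjugate of `τ` by the automorphism `x ↦ x⁻¹`, `y ↦ y`, so `τ ∈ H` by
normality, and `σ ∈ H`.

*The index.* The core of `π⁻¹(K)` is the intersection of four conjugates, so that `[F₂ : N]`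
divides `36 n⁴`, and the dimension of `N / N' Nᵖ` over `ℤ/pℤ` is at most `[F₂ : N] + 1`
(`relIndex_derivedPow_dvd`); the factor `4` is the index of `F₂' F₂⁴` in `F₂' F₂²`, which contains
`N`.
-/

/-! ### Cancellation in free groups -/

/-- The length of the longest common prefix of two lists. -/
def List.commonPrefixLength {β : Type*} [DecidableEq β] : List β → List β → ℕ
  | s :: l, t :: m => if s = t then commonPrefixLength l m + 1 else 0
  | _, _ => 0

theorem List.min_commonPrefixLength_le {β : Type*} [DecidableEq β] :
    ∀ l m k : List β, min (l.commonPrefixLength m) (m.commonPrefixLength k) ≤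
      l.commonPrefixLength k
  | [], _, _ => by simp [commonPrefixLength]
  | _ :: _, [], _ => by simp [commonPrefixLength]
  | _ :: _, _ :: _, [] => by simp [commonPrefixLength]
  | s :: l, t :: m, r :: k => by
    have ih := min_commonPrefixLength_le l m k
    simp only [commonPrefixLength]
    split_ifs with h1 h2 h3 h3 <;> simp_all

theorem List.take_eq_of_le_commonPrefixLength {β : Type*} [DecidableEq β] :
    ∀ (l m : List β) (k : ℕ), k ≤ l.commonPrefixLength m → l.take k = m.take k
  | [], m, k, h => by
    have : k = 0 := by simpa [commonPrefixLength] using h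
    simp [this]
  | _ :: _, [], k, h => by
    have : k = 0 := by simpa [commonPrefixLength] using h
    simp [this]
  | s :: l, t :: m, k, h => by
    simp only [commonPrefixLength] at h
    split_ifs at h with hst
    · cases k with
      | zero => simp
      | succ k => simp [hst, take_eq_of_le_commonPrefixLength l m k (by omega)]
    · have : k = 0 := by omega
      simp [this]

namespace FreeGroup

variable {α : Type*} [DecidableEq α]

/-- The length of the longest common prefix of the reduced words of `g` and `h`, that is, the
Gromov product of `g` and `h` in the Cayley tree with base point `1`. -/
def gromovProd (g h : FreeGroup α) : ℕ := g.toWord.commonPrefixLength h.toWord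

/-- Cancelling the common prefix of two reduced words `l` and `m` leaves a reduced word for
`l⁻¹ m`. -/
theorem norm_inv_mk_mul_mk :
    ∀ l m : List (α × Bool), IsReduced l → IsReduced m →
      ((mk l)⁻¹ * mk m).norm + 2 * l.commonPrefixLength m = l.length + m.length
  | [], m, _, hm => by
    rw [← one_eq_mk, inv_one, one_mul, norm, toWord_mk, hm.reduce_eq]
    simp [List.commonPrefixLength]
  | s :: l, [], hl, _ => by
    rw [← one_eq_mk, mul_one, norm_inv_eq, norm, toWord_mk, hl.reduce_eq]
    simp [List.commonPrefixLength]
  | s :: l, t :: m, hl, hm => by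
    by_cases hst : s = t
    · subst hst
      have ih := norm_inv_mk_mul_mk l m (hl.infix (List.suffix_cons _ _).isInfix)
        (hm.infix (List.suffix_cons _ _).isInfix)
      have h : (mk (s :: l))⁻¹ * mk (s :: m) = (mk l)⁻¹ * mk m := by
        have hc (k : List (α × Bool)) : mk (s :: k) = mk [s] * mk k := by simp
        rw [hc l, hc m]
        group
      simp only [List.commonPrefixLength, if_true, List.length_cons, h]
      omega
    · have hred : IsReduced (invRev (s :: l) ++ t :: m) := by
        have h1 : IsReduced (invRev (s :: l)) := by
          have := isReduced_toWord (x := (mk (s :: l))⁻¹)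
          rwa [toWord_inv, toWord_mk, hl.reduce_eq] at this
        refine List.isChain_append.2 ⟨h1, hm, ?_⟩
        intro c hc d hd
        simp only [invRev, List.map_cons, List.reverse_cons, List.getLast?_append,
          List.getLast?_singleton, Option.some_or, Option.mem_def, Option.some.injEq,
          List.head?_cons] at hc hd
        subst hc hd
        intro h
        by_contra h'
        refine hst (Prod.ext h ?_)
        revert h'
        cases s.2 <;> cases t.2 <;> simp
      rw [inv_mk, mul_mk, norm, toWord_mk, hred.reduce_eq]
      simp [List.commonPrefixLength, hst]

theorem norm_inv_mul (g h : FreeGroup α) :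
    (g⁻¹ * h).norm + 2 * gromovProd g h = g.norm + h.norm := by
  have := norm_inv_mk_mul_mk _ _ (isReduced_toWord (x := g)) (isReduced_toWord (x := h))
  rwa [mk_toWord, mk_toWord] at this

theorem norm_mul (g h : FreeGroup α) :
    (g * h).norm + 2 * gromovProd g⁻¹ h = g.norm + h.norm := by
  simpa [norm_inv_eq] using norm_inv_mul g⁻¹ h

theorem gromovProd_comm (g h : FreeGroup α) : gromovProd g h = gromovProd h g := by
  have h1 := norm_inv_mul g h
  have h2 := norm_inv_mul h g
  have h3 : (g⁻¹ * h).norm = (h⁻¹ * g).norm := by rw [← norm_inv_eq]; simp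
  omega

/-- The ultrametric inequality: the Cayley tree is `0`-hyperbolic. -/
theorem min_gromovProd_le (g h k : FreeGroup α) :
    min (gromovProd g h) (gromovProd h k) ≤ gromovProd g k :=
  List.min_commonPrefixLength_le _ _ _

/-- Less than half of a nontrivial reduced word is cancelled when the word is squared. -/
theorem two_mul_gromovProd_inv_lt {g : FreeGroup α} (hg : g ≠ 1) :
    2 * gromovProd g⁻¹ g < g.norm := by
  by_contra! hlt
  have hsq : (g * g).norm + 2 * gromovProd g⁻¹ g = g.norm + g.norm := norm_mul g g
  -- `k` is half the length: the first half of `g` would be the inverse of the second half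
  obtain ⟨k, hk⟩ : ∃ k, g.norm = 2 * k ∨ g.norm = 2 * k + 1 := ⟨g.norm / 2, by omega⟩
  have hk' : g.norm ≤ 2 * k := by
    rcases hk with hk | hk
    · exact hk.le
    · exfalso
      -- an odd length would make the middle letter its own inverse
      have hle : k + 1 ≤ gromovProd g⁻¹ g := by omega
      have := List.take_eq_of_le_commonPrefixLength _ _ _ hle
      have h1 : g⁻¹.toWord[k]? = g.toWord[k]? := by
        have := congrArg (fun l => l[k]?) this
        simpa [List.getElem?_take] using this
      rw [toWord_inv, invRev, List.getElem?_reverse (by simp; unfold norm at hk; omega)] at h1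
      unfold norm at hk
      rw [List.length_map, hk, show 2 * k + 1 - 1 - k = k by omega, List.getElem?_map,
        List.getElem?_eq_getElem (by omega)] at h1
      simp only [Option.map_some, Option.some.injEq] at h1
      have := congrArg Prod.snd h1
      simp at this
  have hle : k ≤ gromovProd g⁻¹ g := by omega
  have htake := List.take_eq_of_le_commonPrefixLength _ _ _ hle
  have hlen : g.toWord.length = 2 * k := by unfold norm at hk hk'; omega
  have h1 : g⁻¹.toWord.take k = invRev (g.toWord.drop k) := by
    rw [toWord_inv, invRev, invRev, List.take_reverse, List.map_drop]
    simp [hlen, two_mul]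
  refine hg ?_
  rw [← mk_toWord (x := g), ← List.take_append_drop k g.toWord, ← mul_mk, ← htake, h1, ← inv_mk,
    inv_mul_cancel]

theorem exists_norm_eq_one_gromovProd {g : FreeGroup α} (hg : g ≠ 1) :
    ∃ s : FreeGroup α, s.norm = 1 ∧ 1 ≤ gromovProd s g := by
  cases h : g.toWord with
  | nil => exact absurd (toWord_eq_nil_iff.1 h) hg
  | cons t l =>
    have h1 : (mk [t]).toWord = [t] := by rw [toWord_mk, reduce_singleton]
    refine ⟨mk [t], by simp [norm, h1], ?_⟩
    simp [gromovProd, h1, h, List.commonPrefixLength]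

theorem eq_of_norm_eq_one {g : FreeGroup α} (hg : g.norm = 1) :
    ∃ i, g = of i ∨ g = (of i)⁻¹ := by
  obtain ⟨⟨i, e⟩, h⟩ := List.length_eq_one_iff.1 hg
  refine ⟨i, ?_⟩
  rw [← mk_toWord (x := g), h]
  cases e
  · right; simp [of, inv_mk, invRev]
  · left; rfl

/-- If the images of the letters under a homomorphism satisfy Nielsen's conditions on
cancellation, then the homomorphism does not shorten words. -/
theorem norm_le_norm_map_of_nielsen (f : FreeGroup α →* FreeGroup α)
    (hne : ∀ s, f (mk [s]) ≠ 1)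
    (h1 : ∀ s t : α × Bool, (s.1 = t.1 → s.2 = t.2) →
      2 * gromovProd (f (mk [s]))⁻¹ (f (mk [t])) ≤ (f (mk [t])).norm)
    (h2 : ∀ r s t : α × Bool, (r.1 = s.1 → r.2 = s.2) → (s.1 = t.1 → s.2 = t.2) →
      gromovProd (f (mk [r]))⁻¹ (f (mk [s])) + gromovProd (f (mk [s]))⁻¹ (f (mk [t])) <
        (f (mk [s])).norm)
    (g : FreeGroup α) : g.norm ≤ (f g).norm := by
  -- The letter `r` in front only serves to record what is left of the image of `s` after the
  -- cancellation on its left.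
  have key : ∀ (l : List (α × Bool)) (r s : α × Bool), IsReduced (r :: s :: l) →
      gromovProd (f (mk [r]))⁻¹ (f (mk (s :: l))) = gromovProd (f (mk [r]))⁻¹ (f (mk [s])) ∧
      l.length + gromovProd (f (mk [r]))⁻¹ (f (mk [s])) + 1 ≤ (f (mk (s :: l))).norm := by
    intro l
    induction l with
    | nil =>
      intro r s h
      refine ⟨rfl, ?_⟩
      have hrs : r.1 = s.1 → r.2 = s.2 := by simpa [IsReduced] using h
      have hpos : (f (mk [s])).norm ≠ 0 := by simpa using hne s
      have := h1 r s hrs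
      simp only [List.length_nil]
      omega
    | cons t l ih =>
      intro r s h
      have h' : IsReduced (s :: t :: l) := h.infix (List.suffix_cons _ _).isInfix
      obtain ⟨hc, hn⟩ := ih s t h'
      have hrs : r.1 = s.1 → r.2 = s.2 := (List.isChain_cons_cons.1 h).1
      have hst : s.1 = t.1 → s.2 = t.2 := (List.isChain_cons_cons.1 h').1
      have hN := h2 r s t hrs hst
      have hW : f (mk (s :: t :: l)) = f (mk [s]) * f (mk (t :: l)) := by
        rw [← _root_.map_mul, mul_mk]; rfl
      have hlen := norm_mul (f (mk [s])) (f (mk (t :: l)))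
      rw [← hW, hc] at hlen
      have hlen' := norm_inv_mul (f (mk [s])) (f (mk (s :: t :: l)))
      rw [show (f (mk [s]))⁻¹ * f (mk (s :: t :: l)) = f (mk (t :: l)) by rw [hW]; group] at hlen'
      have m1 := min_gromovProd_le (f (mk [r]))⁻¹ (f (mk [s])) (f (mk (s :: t :: l)))
      have m2 := min_gromovProd_le (f (mk [r]))⁻¹ (f (mk (s :: t :: l))) (f (mk [s]))
      rw [gromovProd_comm (f (mk (s :: t :: l)))] at m2
      simp only [List.length_cons]
      constructor <;> omega
  cases h : g.toWord with
  | nil => simp [norm, h]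
  | cons s l =>
    -- doubling the first letter supplies a letter in front without spoiling reducedness
    have hr : IsReduced (s :: s :: l) := by
      have := isReduced_toWord (x := g)
      rw [h] at this
      exact List.isChain_cons_cons.2 ⟨fun _ => rfl, this⟩
    have := (key l s s hr).2
    rw [← h, mk_toWord] at this
    have hg : g.norm = l.length + 1 := by simp [norm, h]
    omega

end FreeGroup

namespace FreeTwo

open FreeGroup

/-! ### Nielsen reduction of bases -/

/-- The automorphism exchanging `x` and `y`. -/
def swapXY : MulAut F :=
  MonoidHom.toMulEquiv (FreeGroup.lift ![y, x]) (FreeGroup.lift ![y, x])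
    (by ext i; fin_cases i <;> simp [x, y]) (by ext i; fin_cases i <;> simp [x, y])

/-- The automorphism `x ↦ x⁻¹`, `y ↦ y`. -/
def invX : MulAut F :=
  MonoidHom.toMulEquiv (FreeGroup.lift ![x⁻¹, y]) (FreeGroup.lift ![x⁻¹, y])
    (by ext i; fin_cases i <;> simp [x, y]) (by ext i; fin_cases i <;> simp [x, y])

/-- The automorphism `x ↦ x y`, `y ↦ y`. -/
def transv : MulAut F :=
  MonoidHom.toMulEquiv (FreeGroup.lift ![x * y, y]) (FreeGroup.lift ![x * y⁻¹, y])
    (by ext i; fin_cases i <;> simp [x, y]) (by ext i; fin_cases i <;> simp [x, y])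

@[simp] theorem swapXY_x : swapXY x = y := by simp [swapXY, x]
@[simp] theorem swapXY_y : swapXY y = x := by simp [swapXY, y]
@[simp] theorem invX_x : invX x = x⁻¹ := by simp [invX, x]
@[simp] theorem invX_y : invX y = y := by simp [invX, y]
@[simp] theorem transv_x : transv x = x * y := by simp [transv, x]
@[simp] theorem transv_y : transv y = y := by simp [transv, y]

theorem mulAut_ext {σ τ : MulAut F} (hx : σ x = τ x) (hy : σ y = τ y) : σ = τ := by
  have : σ.toMonoidHom = τ.toMonoidHom := by
    refine FreeGroup.ext_hom _ _ fun i => ?_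
    fin_cases i
    exacts [hx, hy]
  exact MulEquiv.ext fun w => DFunLike.congr_fun this w

/-- `u, v` is the image of the standard basis under an element of the coset `σ T`. -/
def IsBasisIn (T : Subgroup (MulAut F)) (σ : MulAut F) (u v : F) : Prop :=
  ∃ τ ∈ T, (σ * τ) x = u ∧ (σ * τ) y = v

section Nielsen

variable {T : Subgroup (MulAut F)} (hI : Inn ≤ T) (hs : swapXY ∈ T) (hi : invX ∈ T)
  (ht : transv ∈ T) {σ : MulAut F} {u v : F}

theorem IsBasisIn.swap (hs : swapXY ∈ T) (h : IsBasisIn T σ u v) : IsBasisIn T σ v u := by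
  obtain ⟨τ, hτ, hu, hv⟩ := h
  exact ⟨τ * swapXY, T.mul_mem hτ hs, by simpa using hv, by simpa using hu⟩

theorem IsBasisIn.inv_left (hi : invX ∈ T) (h : IsBasisIn T σ u v) : IsBasisIn T σ u⁻¹ v := by
  obtain ⟨τ, hτ, hu, hv⟩ := h
  exact ⟨τ * invX, T.mul_mem hτ hi, by simpa using hu, by simpa using hv⟩

theorem IsBasisIn.mul_left (ht : transv ∈ T) (h : IsBasisIn T σ u v) :
    IsBasisIn T σ (u * v) v := by
  obtain ⟨τ, hτ, rfl, rfl⟩ := h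
  exact ⟨τ * transv, T.mul_mem hτ ht, by simp, by simp⟩

/-- Conjugation stays in the coset because `σ⁻¹ Inn(F₂) σ = Inn(F₂)`. -/
theorem IsBasisIn.conj (hI : Inn ≤ T) (h : IsBasisIn T σ u v) (g : F) :
    IsBasisIn T σ (g * u * g⁻¹) (g * v * g⁻¹) := by
  obtain ⟨τ, hτ, rfl, rfl⟩ := h
  exact ⟨MulAut.conj (σ⁻¹ g) * τ, T.mul_mem (hI ⟨_, rfl⟩) hτ, by simp, by simp⟩

theorem IsBasisIn.ne (h : IsBasisIn T σ u v) : u ≠ v := by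
  obtain ⟨τ, hτ, rfl, rfl⟩ := h
  rw [Ne, (MulEquiv.injective _).eq_iff]
  exact fun h => absurd (FreeGroup.of_injective h) (by decide)

theorem IsBasisIn.ne_one (h : IsBasisIn T σ u v) : u ≠ 1 := by
  obtain ⟨τ, hτ, rfl, rfl⟩ := h
  rw [Ne, map_eq_one_iff _ (MulEquiv.injective _)]
  exact FreeGroup.of_ne_one 0

/-- The basis `u, v` has least total length among those in the coset `σ T`. -/
def IsMinBasisIn (T : Subgroup (MulAut F)) (σ : MulAut F) (u v : F) : Prop :=
  IsBasisIn T σ u v ∧ ∀ u' v', IsBasisIn T σ u' v' → u.norm + v.norm ≤ u'.norm + v'.norm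

theorem IsMinBasisIn.swap (hs : swapXY ∈ T) (h : IsMinBasisIn T σ u v) :
    IsMinBasisIn T σ v u :=
  ⟨h.1.swap hs, fun u' v' h' => by have := h.2 u' v' h'; omega⟩

theorem IsMinBasisIn.inv_left (hi : invX ∈ T) (h : IsMinBasisIn T σ u v) :
    IsMinBasisIn T σ u⁻¹ v :=
  ⟨h.1.inv_left hi, fun u' v' h' => by have := h.2 u' v' h'; rw [norm_inv_eq]; omega⟩

theorem IsMinBasisIn.inv_right (hs : swapXY ∈ T) (hi : invX ∈ T) (h : IsMinBasisIn T σ u v) :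
    IsMinBasisIn T σ u v⁻¹ :=
  ((h.swap hs).inv_left hi).swap hs

include hs hi ht in
theorem IsMinBasisIn.two_mul_gromovProd_le (h : IsMinBasisIn T σ u v) :
    2 * gromovProd u⁻¹ v ≤ u.norm ∧ 2 * gromovProd u⁻¹ v ≤ v.norm := by
  have h1 := norm_mul u v
  have h2 := h.2 _ _ (h.1.mul_left ht)
  have h3 : IsBasisIn T σ (v⁻¹ * u⁻¹) u⁻¹ :=
    (((h.1.swap hs).inv_left hi).swap hs |>.inv_left hi |>.swap hs).mul_left ht
  have h4 := h.2 _ _ h3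
  rw [← mul_inv_rev, norm_inv_eq, norm_inv_eq] at h4
  omega

include hs hi ht in
/-- In a basis of least total length, at most half of a letter is cancelled by a neighbour. -/
theorem IsMinBasisIn.two_mul_gromovProd_le' (h : IsMinBasisIn T σ u v) {c : F}
    (hc : c = u ∨ c = v ∨ c = v⁻¹) :
    2 * gromovProd c⁻¹ u ≤ u.norm ∧ 2 * gromovProd u⁻¹ c ≤ u.norm := by
  rcases hc with rfl | rfl | rfl
  · have := two_mul_gromovProd_inv_lt h.1.ne_one
    omega
  · exact ⟨((h.swap hs).two_mul_gromovProd_le hs hi ht).2,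
      (h.two_mul_gromovProd_le hs hi ht).1⟩
  · exact ⟨(((h.inv_right hs hi).swap hs).two_mul_gromovProd_le hs hi ht).2,
      ((h.inv_right hs hi).two_mul_gromovProd_le hs hi ht).1⟩

include hI hs hi ht in
/-- In a basis of least total length, a letter is not used up by the cancellations on its two
sides. The critical case is `v u v` with one half of `u` cancelled on each side: then conjugation
by the first letter of `u` shortens the basis `u, u v`. -/
theorem IsMinBasisIn.gromovProd_add_lt (h : IsMinBasisIn T σ u v) {a c : F}
    (ha : a = u ∨ a = v ∨ a = v⁻¹) (hc : c = u ∨ c = v ∨ c = v⁻¹) :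
    gromovProd a⁻¹ u + gromovProd u⁻¹ c < u.norm := by
  have hu := two_mul_gromovProd_inv_lt h.1.ne_one
  by_contra! hlt
  have la := (h.two_mul_gromovProd_le' hs hi ht ha).1
  have lc := (h.two_mul_gromovProd_le' hs hi ht hc).2
  have critical : ∀ w : F, IsMinBasisIn T σ u w →
      ¬ (2 * gromovProd w⁻¹ u = u.norm ∧ 2 * gromovProd u⁻¹ w = u.norm) := by
    rintro w hw ⟨h1, h2⟩
    obtain ⟨s, hs1, hsu⟩ := exists_norm_eq_one_gromovProd h.1.ne_one
    have hwu := ((hw.swap hs).two_mul_gromovProd_le hs hi ht).1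
    have hpos : u.norm ≠ 0 := by simpa using h.1.ne_one
    -- `u w` has the length of `w`, and both it and its inverse begin with the first letter of `u`
    have n1 := norm_mul u w
    have g1 := norm_inv_mul u (u * w)
    rw [inv_mul_cancel_left] at g1
    have g2 := norm_inv_mul w⁻¹ (u * w)⁻¹
    rw [show w⁻¹⁻¹ * (u * w)⁻¹ = u⁻¹ by group, norm_inv_eq, norm_inv_eq, norm_inv_eq] at g2
    have m1 := min_gromovProd_le s u (u * w)
    have m2 := min_gromovProd_le s u (u * w)⁻¹
    have m3 := min_gromovProd_le u w⁻¹ (u * w)⁻¹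
    rw [gromovProd_comm u] at m3
    have k1 := norm_inv_mul s (u * w)
    have k2 := norm_inv_mul s (u * w)⁻¹
    have k3 := norm_inv_mul ((u * w)⁻¹ * s) (u * w)⁻¹
    rw [show ((u * w)⁻¹ * s)⁻¹ * (u * w)⁻¹ = s⁻¹ by group, norm_inv_eq, norm_inv_eq] at k3
    have k4 := norm_inv_mul s ((u * w)⁻¹ * s)
    have k5 : ((u * w)⁻¹ * s).norm = (s⁻¹ * (u * w)).norm := by rw [← norm_inv_eq]; simp
    have m4 := min_gromovProd_le s (u * w)⁻¹ ((u * w)⁻¹ * s)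
    rw [gromovProd_comm (u * w)⁻¹ ((u * w)⁻¹ * s)] at m4
    have e1 : (s⁻¹ * (u * w) * s).norm = (s⁻¹ * ((u * w)⁻¹ * s)).norm := by
      rw [← norm_inv_eq]; simp [mul_assoc]
    have k6 := norm_inv_mul s u
    have k7 := norm_mul_le (s⁻¹ * u) s
    have hb : IsBasisIn T σ (u * w)⁻¹ u⁻¹ := by
      rw [mul_inv_rev]
      exact ((hw.swap hs).inv_left hi |>.inv_right hs hi).1.mul_left ht
    have hmin := h.2 _ _ (hb.conj hI s⁻¹)
    have hmin' := hw.2 _ _ h.1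
    have hmin'' := h.2 _ _ hw.1
    have e2 : ∀ g : F, (s⁻¹ * g⁻¹ * s⁻¹⁻¹).norm = (s⁻¹ * g * s).norm := fun g => by
      rw [← norm_inv_eq]; simp [mul_assoc]
    rw [e2, e2] at hmin
    omega
  have hne : ¬ (2 * gromovProd a⁻¹ u = u.norm ∧ 2 * gromovProd u⁻¹ c = u.norm) := by
    rintro ⟨h1, h2⟩
    -- opposite neighbours would make the two halves of `u` inverse to each other
    have opp : c ≠ a⁻¹ := by
      rintro rfl
      have := min_gromovProd_le u⁻¹ a⁻¹ u
      omega
    rcases ha with rfl | rfl | rfl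
    · omega
    · rcases hc with rfl | rfl | rfl
      · omega
      · exact critical _ h ⟨h1, h2⟩
      · exact opp rfl
    · rcases hc with rfl | rfl | rfl
      · omega
      · exact opp (inv_inv _).symm
      · exact critical _ (h.inv_right hs hi) ⟨h1, h2⟩
  omega

include hI hs hi ht in
/-- Nielsen: a subgroup containing the inner automorphisms and the elementary Nielsen
transformations is all of `Aut F₂`. -/
theorem eq_top_of_nielsen_mem : T = ⊤ := by
  rw [eq_top_iff]
  rintro σ -
  obtain ⟨u, v, hmin⟩ : ∃ u v, IsMinBasisIn T σ u v := by
    classical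
    have hex : ∃ n, ∃ u v, IsBasisIn T σ u v ∧ u.norm + v.norm = n :=
      ⟨_, _, _, ⟨1, T.one_mem, rfl, rfl⟩, rfl⟩
    obtain ⟨u, v, huv, hn⟩ := Nat.find_spec hex
    exact ⟨u, v, huv, fun u' v' h' => hn ▸ Nat.find_min' hex ⟨u', v', h', rfl⟩⟩
  obtain ⟨τ, hτ, hu, hv⟩ := hmin.1
  have hpos : (σ * τ) (FreeGroup.mk [((0 : Fin 2), true)]) = u := hu
  have hpos' : (σ * τ) (FreeGroup.mk [((1 : Fin 2), true)]) = v := hv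
  have hneg : (σ * τ) (FreeGroup.mk [((0 : Fin 2), false)]) = u⁻¹ := by
    rw [← hpos, ← _root_.map_inv, inv_mk]; rfl
  have hneg' : (σ * τ) (FreeGroup.mk [((1 : Fin 2), false)]) = v⁻¹ := by
    rw [← hpos', ← _root_.map_inv, inv_mk]; rfl
  have letters : ∀ s : Fin 2 × Bool, ∃ w, IsMinBasisIn T σ ((σ * τ) (FreeGroup.mk [s])) w ∧
      ∀ r : Fin 2 × Bool, (r.1 = s.1 → r.2 = s.2) →
        (σ * τ) (FreeGroup.mk [r]) = (σ * τ) (FreeGroup.mk [s]) ∨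
        (σ * τ) (FreeGroup.mk [r]) = w ∨ (σ * τ) (FreeGroup.mk [r]) = w⁻¹ := by
    rintro ⟨i, e⟩
    fin_cases i <;> cases e
    · refine ⟨v, by simpa only [Fin.zero_eta, hneg] using hmin.inv_left hi, ?_⟩
      rintro ⟨j, e'⟩ hj
      fin_cases j <;> cases e' <;> simp_all
    · refine ⟨v, by simpa only [Fin.zero_eta, hpos] using hmin, ?_⟩
      rintro ⟨j, e'⟩ hj
      fin_cases j <;> cases e' <;> simp_all
    · refine ⟨u, by simpa only [Fin.mk_one, hneg'] using (hmin.swap hs).inv_left hi, ?_⟩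
      rintro ⟨j, e'⟩ hj
      fin_cases j <;> cases e' <;> simp_all
    · refine ⟨u, by simpa only [Fin.mk_one, hpos'] using hmin.swap hs, ?_⟩
      rintro ⟨j, e'⟩ hj
      fin_cases j <;> cases e' <;> simp_all
  -- so `σ τ` does not shorten words
  have key (g : F) : g.norm ≤ ((σ * τ) g).norm := by
    refine norm_le_norm_map_of_nielsen (σ * τ).toMonoidHom ?_ ?_ ?_ g
    · intro s
      obtain ⟨w, hw, -⟩ := letters s
      exact hw.1.ne_one
    · intro s t hst
      obtain ⟨w, hw, h⟩ := letters t
      exact (hw.two_mul_gromovProd_le' hs hi ht (h s hst)).1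
    · intro r s t hrs hst
      obtain ⟨w, hw, h⟩ := letters s
      exact hw.gromovProd_add_lt hI hs hi ht (h r hrs) (h t fun h' => (hst h'.symm).symm)
  -- the inverse maps letters to letters
  have hletter (j : Fin 2) : ∃ i, (σ * τ)⁻¹ (of j) = of i ∨ (σ * τ)⁻¹ (of j) = (of i)⁻¹ := by
    refine eq_of_norm_eq_one (le_antisymm ?_ ?_)
    · simpa using key ((σ * τ)⁻¹ (of j))
    · rw [Nat.one_le_iff_ne_zero, Ne, FreeGroup.norm_eq_zero, map_eq_one_iff _ (MulEquiv.injective _)]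
      exact FreeGroup.of_ne_one j
  have hb : IsBasisIn T (σ * τ)⁻¹ ((σ * τ)⁻¹ (of 0)) ((σ * τ)⁻¹ (of 1)) :=
    ⟨1, T.one_mem, rfl, rfl⟩
  obtain ⟨i, hi'⟩ := hletter 0
  obtain ⟨j, hj'⟩ := hletter 1
  have hb1 : IsBasisIn T (σ * τ)⁻¹ (of i) ((σ * τ)⁻¹ (of 1)) := by
    rcases hi' with h | h
    · rwa [h] at hb
    · have := hb.inv_left hi
      rwa [h, inv_inv] at this
  have hb2 : IsBasisIn T (σ * τ)⁻¹ (of i) (of j) := by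
    rcases hj' with h | h
    · rwa [h] at hb1
    · have := ((hb1.swap hs).inv_left hi).swap hs
      rwa [h, inv_inv] at this
  have hb3 : IsBasisIn T (σ * τ)⁻¹ x y := by
    have hne := hb2.ne
    fin_cases i <;> fin_cases j
    · exact absurd rfl hne
    · exact hb2
    · exact hb2.swap hs
    · exact absurd rfl hne
  obtain ⟨ρ, hρ, h1, h2⟩ := hb3
  have h3 : (σ * τ)⁻¹ * ρ = 1 := mulAut_ext h1 h2
  have h4 : σ = ρ * τ⁻¹ := by
    rw [inv_mul_eq_one] at h3
    rw [← h3]; group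
  rw [h4]
  exact T.mul_mem hρ (T.inv_mem hτ)

end Nielsen
end FreeTwo

namespace FreeTwo

/-! ### Automorphisms congruent to the identity modulo four -/

/-- The action of an automorphism on `F₂ / F₂' F₂ᵐ = (ℤ/mℤ)²`, as a matrix. -/
def abMatrixMod (m : ℕ) : MulAut F →* Matrix (Fin 2) (Fin 2) (ZMod m) :=
  (Int.castRingHom (ZMod m)).mapMatrix.toMonoidHom.comp abMatrix

theorem abMatrixMod_apply (m : ℕ) (σ : MulAut F) (i j : Fin 2) :
    abMatrixMod m σ i j = (expSum i (σ (FreeGroup.of j)) : ZMod m) := rfl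

theorem abMatrixMod_eq (m : ℕ) (σ : MulAut F) : abMatrixMod m σ =
    !![(expSum 0 (σ x) : ZMod m), (expSum 0 (σ y) : ZMod m);
      (expSum 1 (σ x) : ZMod m), (expSum 1 (σ y) : ZMod m)] := by
  ext i j
  fin_cases i <;> fin_cases j <;> rfl

theorem expSum_mul (i : Fin 2) (g h : F) : expSum i (g * h) = expSum i g + expSum i h := by
  simp [expSum]

theorem expSum_inv (i : Fin 2) (g : F) : expSum i g⁻¹ = -expSum i g := by
  simp [expSum]

theorem expSum_one (i : Fin 2) : expSum i 1 = 0 := by simp [expSum]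

theorem expSum_pow (i : Fin 2) (g : F) (k : ℕ) : expSum i (g ^ k) = k * expSum i g := by
  simp [expSum]

theorem expSum_x (i : Fin 2) : expSum i x = if 0 = i then 1 else 0 := by
  simp [expSum, expHom, x]

theorem expSum_y (i : Fin 2) : expSum i y = if 1 = i then 1 else 0 := by
  simp [expSum, expHom, y]

theorem abMatrixMod_conj (m : ℕ) (g : F) : abMatrixMod m (MulAut.conj g) = 1 := by
  rw [abMatrixMod_eq]
  ext i j
  fin_cases i <;> fin_cases j <;>
    simp [expSum_mul, expSum_inv, expSum_x, expSum_y]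

/-- The automorphism `x ↦ x`, `y ↦ y⁻¹`. -/
def invY : MulAut F := swapXY * invX * swapXY

@[simp] theorem invY_x : invY x = x := by simp [invY]
@[simp] theorem invY_y : invY y = y⁻¹ := by simp [invY]

/-- The subgroup `Inn(F₂) ⟨α, β⟩`. -/
def innA : Subgroup (MulAut F) := Inn ⊔ A

/-- The subgroup generated by the sign changes of the two generators. -/
def signs : Subgroup (MulAut F) := Subgroup.closure {invX, invY}

/-- The group generated by `Inn(F₂)`, `α`, `β` and the sign changes; it turns out to be the group
of all automorphisms congruent to the identity modulo two. -/
def levelTwo : Subgroup (MulAut F) := innA ⊔ signs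

theorem conj_mem_innA (g : F) : MulAut.conj g ∈ innA := Subgroup.mem_sup_left ⟨g, rfl⟩
theorem alpha_mem_innA : alpha ∈ innA := Subgroup.mem_sup_right a.2
theorem beta_mem_innA : beta ∈ innA := Subgroup.mem_sup_right b.2

theorem conj_mem_levelTwo (g : F) : MulAut.conj g ∈ levelTwo :=
  Subgroup.mem_sup_left (conj_mem_innA g)
theorem alpha_mem_levelTwo : alpha ∈ levelTwo := Subgroup.mem_sup_left alpha_mem_innA
theorem beta_mem_levelTwo : beta ∈ levelTwo := Subgroup.mem_sup_left beta_mem_innA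
theorem invX_mem_levelTwo : invX ∈ levelTwo :=
  Subgroup.mem_sup_right (Subgroup.subset_closure (by simp))
theorem invY_mem_levelTwo : invY ∈ levelTwo :=
  Subgroup.mem_sup_right (Subgroup.subset_closure (by simp))

instance inn_normal : Inn.Normal where
  conj_mem := by
    rintro _ ⟨g, rfl⟩ σ
    exact ⟨σ g, MulEquiv.ext fun w => by simp⟩

theorem innA_le {T : Subgroup (MulAut F)} (hI : Inn ≤ T) (ha : alpha ∈ T) (hb : beta ∈ T) :
    innA ≤ T :=
  sup_le hI ((Subgroup.closure_le T).2 (by rintro _ (rfl | rfl) <;> assumption))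

theorem levelTwo_le {T : Subgroup (MulAut F)} (hI : Inn ≤ T) (ha : alpha ∈ T) (hb : beta ∈ T)
    (hx : invX ∈ T) (hy : invY ∈ T) : levelTwo ≤ T :=
  sup_le (innA_le hI ha hb) ((Subgroup.closure_le T).2 (by rintro _ (rfl | rfl) <;> assumption))

/-- An element whose square lies in a subgroup normalizes it as soon as it conjugates the subgroup
into itself. -/
theorem mem_normalizer_of_sq_mem {G : Type*} [Group G] {T : Subgroup G} {g : G} (hg : g * g ∈ T)
    (h : ∀ t ∈ T, g * t * g⁻¹ ∈ T) : g ∈ Subgroup.normalizer (T : Set G) := by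
  rw [Subgroup.mem_normalizer_iff]
  refine fun t => ⟨fun ht => h t ht, fun ht => ?_⟩
  have h1 : g * (g * t * g⁻¹) * g⁻¹ ∈ T := h _ ht
  have h2 : t = (g * g)⁻¹ * (g * (g * t * g⁻¹) * g⁻¹) * (g * g) := by group
  rw [h2]
  exact T.mul_mem (T.mul_mem (T.inv_mem hg) h1) hg

theorem alpha_symm_x : MulEquiv.symm alpha x = x := by
  rw [MulEquiv.symm_apply_eq, alpha_x]
theorem alpha_symm_y : MulEquiv.symm alpha y = y * (x ^ 2)⁻¹ := by
  rw [MulEquiv.symm_apply_eq]; simp [alpha_x, alpha_y]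
theorem beta_symm_x : MulEquiv.symm beta x = x * (y ^ 2)⁻¹ := by
  rw [MulEquiv.symm_apply_eq]; simp [beta_x, beta_y]
theorem beta_symm_y : MulEquiv.symm beta y = y := by
  rw [MulEquiv.symm_apply_eq, beta_y]

theorem swapXY_mul_self : swapXY * swapXY = 1 := mulAut_ext (by simp) (by simp)
theorem invX_mul_self : invX * invX = 1 := mulAut_ext (by simp) (by simp)
theorem invY_mul_self : invY * invY = 1 := mulAut_ext (by simp) (by simp)
theorem swapXY_inv : swapXY⁻¹ = swapXY := inv_eq_of_mul_eq_one_left swapXY_mul_self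
theorem invX_inv : invX⁻¹ = invX := inv_eq_of_mul_eq_one_left invX_mul_self
theorem invY_inv : invY⁻¹ = invY := inv_eq_of_mul_eq_one_left invY_mul_self

theorem swapXY_conj_alpha : swapXY * alpha * swapXY⁻¹ = beta := by
  rw [swapXY_inv]
  apply mulAut_ext <;> simp [alpha_x, alpha_y, beta_x, beta_y]
theorem swapXY_conj_beta : swapXY * beta * swapXY⁻¹ = alpha := by
  rw [swapXY_inv]
  apply mulAut_ext <;> simp [alpha_x, alpha_y, beta_x, beta_y]
theorem swapXY_conj_invX : swapXY * invX * swapXY⁻¹ = invY := by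
  rw [swapXY_inv]; rfl
theorem swapXY_conj_invY : swapXY * invY * swapXY⁻¹ = invX := by
  rw [swapXY_inv]
  apply mulAut_ext <;> simp

theorem invX_conj_alpha : invX * alpha * invX⁻¹ = alpha⁻¹ := by
  rw [invX_inv]
  apply mulAut_ext <;> simp [alpha_x, alpha_y, alpha_symm_x, alpha_symm_y]
theorem invX_conj_beta : invX * beta * invX⁻¹ = MulAut.conj (y⁻¹ * y⁻¹) * beta⁻¹ := by
  rw [invX_inv]
  apply mulAut_ext <;> simp [beta_x, beta_y, beta_symm_x, beta_symm_y, pow_two, mul_assoc]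
theorem invY_conj_alpha : invY * alpha * invY⁻¹ = MulAut.conj (x⁻¹ * x⁻¹) * alpha⁻¹ := by
  rw [invY_inv]
  apply mulAut_ext <;> simp [alpha_x, alpha_y, alpha_symm_x, alpha_symm_y, pow_two, mul_assoc]
theorem invY_conj_beta : invY * beta * invY⁻¹ = beta⁻¹ := by
  rw [invY_inv]
  apply mulAut_ext <;> simp [beta_x, beta_y, beta_symm_x, beta_symm_y]

theorem transv_mul_self : transv * transv = beta := by
  apply mulAut_ext <;> simp [beta_x, beta_y, pow_two, mul_assoc]
theorem transv_conj_alpha : transv * alpha * transv⁻¹ =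
    MulAut.conj (y * x) * (invX * beta⁻¹ * (invY * alpha⁻¹)) := by
  rw [mul_inv_eq_iff_eq_mul]
  apply mulAut_ext <;> simp [alpha_x, alpha_y, alpha_symm_x, alpha_symm_y, beta_symm_x, beta_symm_y,
    pow_two, mul_assoc]
theorem transv_conj_beta : transv * beta * transv⁻¹ = beta := by
  rw [mul_inv_eq_iff_eq_mul]
  apply mulAut_ext <;> simp [beta_x, beta_y, pow_two, mul_assoc]
theorem transv_conj_invX : transv * invX * transv⁻¹ = MulAut.conj y⁻¹ * (invX * beta⁻¹) := by
  rw [mul_inv_eq_iff_eq_mul]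
  apply mulAut_ext <;> simp [beta_symm_x, beta_symm_y, pow_two, mul_assoc]
theorem transv_conj_invY : transv * invY * transv⁻¹ = beta * invY := by
  rw [mul_inv_eq_iff_eq_mul]
  apply mulAut_ext <;> simp [beta_x, beta_y, pow_two, mul_assoc]

theorem swapXY_mul_transv_cubed : (swapXY * transv) ^ 3 = MulAut.conj x * (alpha * invX * beta) := by
  rw [pow_succ, pow_two]
  apply mulAut_ext <;> simp [alpha_x, alpha_y, beta_x, beta_y, pow_two, mul_assoc]

theorem conj_mem_of_mem_innA {T : Subgroup (MulAut F)} {σ : MulAut F} (hI : Inn ≤ T)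
    (ha : σ * alpha * σ⁻¹ ∈ T) (hb : σ * beta * σ⁻¹ ∈ T) : ∀ τ ∈ innA, σ * τ * σ⁻¹ ∈ T :=
  innA_le (T := T.comap (MulAut.conj σ).toMonoidHom)
    (fun _ hτ => hI (inn_normal.conj_mem _ hτ σ)) ha hb

theorem conj_mem_of_mem_levelTwo {T : Subgroup (MulAut F)} {σ : MulAut F} (hI : Inn ≤ T)
    (ha : σ * alpha * σ⁻¹ ∈ T) (hb : σ * beta * σ⁻¹ ∈ T) (hx : σ * invX * σ⁻¹ ∈ T)
    (hy : σ * invY * σ⁻¹ ∈ T) : ∀ τ ∈ levelTwo, σ * τ * σ⁻¹ ∈ T :=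
  levelTwo_le (T := T.comap (MulAut.conj σ).toMonoidHom)
    (fun _ hτ => hI (inn_normal.conj_mem _ hτ σ)) ha hb hx hy

theorem inn_le_levelTwo : Inn ≤ levelTwo := le_sup_left.trans le_sup_left

instance levelTwo_normal : levelTwo.Normal := by
  have ha := alpha_mem_levelTwo
  have hb := beta_mem_levelTwo
  have hx := invX_mem_levelTwo
  have hy := invY_mem_levelTwo
  rw [← Subgroup.normalizer_eq_top_iff]
  refine eq_top_of_nielsen_mem (inn_le_levelTwo.trans Subgroup.le_normalizer) ?_ ?_ ?_
  · refine mem_normalizer_of_sq_mem (by rw [swapXY_mul_self]; exact one_mem _)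
      (conj_mem_of_mem_levelTwo inn_le_levelTwo ?_ ?_ ?_ ?_)
    · rw [swapXY_conj_alpha]; exact hb
    · rw [swapXY_conj_beta]; exact ha
    · rw [swapXY_conj_invX]; exact hy
    · rw [swapXY_conj_invY]; exact hx
  · exact Subgroup.le_normalizer hx
  · refine mem_normalizer_of_sq_mem (by rwa [transv_mul_self])
      (conj_mem_of_mem_levelTwo inn_le_levelTwo ?_ ?_ ?_ ?_)
    · rw [transv_conj_alpha]
      exact mul_mem (conj_mem_levelTwo _) (mul_mem (mul_mem hx (inv_mem hb))
        (mul_mem hy (inv_mem ha)))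
    · rw [transv_conj_beta]; exact hb
    · rw [transv_conj_invX]
      exact mul_mem (conj_mem_levelTwo _) (mul_mem hx (inv_mem hb))
    · rw [transv_conj_invY]; exact mul_mem hb hy

/-- In a group generated by `w` and `r`, with `w² = r² = (w r)³ = 1`, there are at most six
elements. -/
theorem mem_six_of_relations {G : Type*} [Group G] {w r : G} (hw : w * w = 1) (hr : r * r = 1)
    (hwr : (w * r) ^ 3 = 1) :
    ∀ g ∈ Subgroup.closure {w, r}, g = 1 ∨ g = w ∨ g = r ∨ g = w * r ∨ g = r * w ∨
      g = w * r * w := by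
  have hwi : w⁻¹ = w := inv_eq_of_mul_eq_one_left hw
  have hri : r⁻¹ = r := inv_eq_of_mul_eq_one_left hr
  have h2 : r * w * r = w * r * w := by
    have h : r * w * r * (w * r * w) * (r * w) = r * w := by
      calc r * w * r * (w * r * w) * (r * w) = r * (w * r) ^ 3 * w := by
            simp only [pow_succ, pow_zero, one_mul, mul_assoc]
        _ = r * w := by rw [hwr, mul_one]
    rw [mul_eq_right] at h
    rw [eq_inv_of_mul_eq_one_left h]
    simp only [mul_inv_rev, hwi, hri, mul_assoc]
  have hmul : ∀ g s, (g = 1 ∨ g = w ∨ g = r ∨ g = w * r ∨ g = r * w ∨ g = w * r * w) →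
      (s = w ∨ s = r) → (g * s = 1 ∨ g * s = w ∨ g * s = r ∨ g * s = w * r ∨ g * s = r * w ∨
        g * s = w * r * w) := by
    rintro g s hg (rfl | rfl)
    · rcases hg with rfl | rfl | rfl | rfl | rfl | rfl
      · simp
      · simp [hw]
      · simp
      · simp
      · simp [mul_assoc, hw]
      · simp [mul_assoc, hw]
    · rcases hg with rfl | rfl | rfl | rfl | rfl | rfl
      · simp
      · simp
      · simp [hr]
      · simp [mul_assoc, hr]
      · simp [h2]
      · rw [← h2, mul_assoc _ s s, hr]; simp
  intro g hg
  induction hg using Subgroup.closure_induction_right with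
  | one => simp
  | mul_right g _ s hs ih => exact hmul g s ih (by simpa using hs)
  | mul_inv_cancel g _ s hs ih =>
    have hs' : s = w ∨ s = r := by simpa using hs
    have : s⁻¹ = s := by rcases hs' with rfl | rfl <;> assumption
    rw [this]
    exact hmul g s ih hs'

theorem abMatrixMod_alpha (m : ℕ) : abMatrixMod m alpha = !![1, 2; 0, 1] := by
  rw [abMatrixMod_eq]
  simp [alpha_x, alpha_y, expSum_mul, expSum_pow, expSum_x, expSum_y]
theorem abMatrixMod_beta (m : ℕ) : abMatrixMod m beta = !![1, 0; 2, 1] := by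
  rw [abMatrixMod_eq]
  simp [beta_x, beta_y, expSum_mul, expSum_pow, expSum_x, expSum_y]
theorem abMatrixMod_swapXY (m : ℕ) : abMatrixMod m swapXY = !![0, 1; 1, 0] := by
  rw [abMatrixMod_eq]
  simp [expSum_x, expSum_y]
theorem abMatrixMod_transv (m : ℕ) : abMatrixMod m transv = !![1, 0; 1, 1] := by
  rw [abMatrixMod_eq]
  simp [expSum_mul, expSum_x, expSum_y]
theorem abMatrixMod_invX (m : ℕ) : abMatrixMod m invX = !![-1, 0; 0, 1] := by
  rw [abMatrixMod_eq]
  simp [expSum_inv, expSum_x, expSum_y]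
theorem abMatrixMod_invY (m : ℕ) : abMatrixMod m invY = !![1, 0; 0, -1] := by
  rw [abMatrixMod_eq]
  simp [expSum_inv, expSum_x, expSum_y]

theorem levelTwo_le_ker : levelTwo ≤ (abMatrixMod 2).ker := by
  refine levelTwo_le ?_ ?_ ?_ ?_ ?_
  · rintro _ ⟨g, rfl⟩
    exact abMatrixMod_conj 2 g
  all_goals
    rw [MonoidHom.mem_ker]
    simp only [abMatrixMod_alpha, abMatrixMod_beta, abMatrixMod_invX, abMatrixMod_invY,
      CharTwo.two_eq_zero, CharTwo.neg_eq, Matrix.one_fin_two]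

/-- The quotient of `Aut F₂` by `levelTwo` is generated by the images of `swapXY` and `transv`, which
satisfy the relations of the symmetric group on three letters. -/
theorem exists_mul_mem_levelTwo (σ : MulAut F) : ∃ t : MulAut F,
    (t = 1 ∨ t = swapXY ∨ t = transv ∨ t = swapXY * transv ∨ t = transv * swapXY ∨
      t = swapXY * transv * swapXY) ∧ t⁻¹ * σ ∈ levelTwo := by
  let q := QuotientGroup.mk' levelTwo
  have hq {g h : MulAut F} : q g = q h ↔ g⁻¹ * h ∈ levelTwo := QuotientGroup.eq
  have hq1 {g : MulAut F} : q g = 1 ↔ g ∈ levelTwo := QuotientGroup.eq_one_iff g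
  have key := mem_six_of_relations (w := q swapXY) (r := q transv)
    (by rw [← map_mul, swapXY_mul_self, map_one])
    (by rw [← map_mul, transv_mul_self, hq1]; exact beta_mem_levelTwo)
    (by
      rw [← map_mul, ← map_pow, swapXY_mul_transv_cubed, hq1]
      exact mul_mem (conj_mem_levelTwo _)
        (mul_mem (mul_mem alpha_mem_levelTwo invX_mem_levelTwo) beta_mem_levelTwo))
  have htop : (Subgroup.closure {q swapXY, q transv}).comap q = ⊤ := by
    have hle : levelTwo ≤ (Subgroup.closure {q swapXY, q transv}).comap q := fun g hg => by
      rw [Subgroup.mem_comap, hq1.2 hg]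
      exact one_mem _
    refine eq_top_of_nielsen_mem (inn_le_levelTwo.trans hle) ?_ (hle invX_mem_levelTwo) ?_
    · exact Subgroup.subset_closure (by simp)
    · exact Subgroup.subset_closure (by simp)
  have hσ : σ ∈ (Subgroup.closure {q swapXY, q transv}).comap q := htop ▸ Subgroup.mem_top σ
  simp only [← map_mul, ← map_one q] at key
  rcases key _ hσ with h | h | h | h | h | h
  exacts [⟨1, by simp, hq.1 h.symm⟩, ⟨_, by simp, hq.1 h.symm⟩, ⟨_, by simp, hq.1 h.symm⟩,
    ⟨_, by simp, hq.1 h.symm⟩, ⟨_, by simp, hq.1 h.symm⟩, ⟨_, by simp, hq.1 h.symm⟩]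

/-- The six coset representatives have different matrices modulo two. -/
theorem mem_levelTwo_of_abMatrixMod {σ : MulAut F} (h : abMatrixMod 2 σ = 1) :
    σ ∈ levelTwo := by
  obtain ⟨t, ht, hσ⟩ := exists_mul_mem_levelTwo σ
  have h1 : abMatrixMod 2 t = 1 := by
    have h2 : abMatrixMod 2 (t⁻¹ * σ) = 1 := levelTwo_le_ker hσ
    have h3 : abMatrixMod 2 σ = abMatrixMod 2 t * abMatrixMod 2 (t⁻¹ * σ) := by
      rw [← map_mul, mul_inv_cancel_left]
    rw [← h, h3, h2, mul_one]
  suffices t = 1 by simpa [this] using hσ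
  rcases ht with rfl | rfl | rfl | rfl | rfl | rfl
  · rfl
  all_goals
    exfalso
    rw [← Matrix.ext_iff] at h1
    simp [abMatrixMod_swapXY, abMatrixMod_transv, Fin.forall_fin_two] at h1

theorem signs_apply {σ : MulAut F} (hσ : σ ∈ signs) :
    (σ x = x ∨ σ x = x⁻¹) ∧ (σ y = y ∨ σ y = y⁻¹) := by
  induction hσ using Subgroup.closure_induction_right with
  | one => simp
  | mul_right g _ s hs ih =>
    obtain ⟨h1, h2⟩ := ih
    rcases hs with rfl | rfl <;> rcases h1 with h1 | h1 <;> rcases h2 with h2 | h2 <;>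
      simp [h1, h2]
  | mul_inv_cancel g _ s hs ih =>
    obtain ⟨h1, h2⟩ := ih
    rcases hs with rfl | rfl <;> rcases h1 with h1 | h1 <;> rcases h2 with h2 | h2 <;>
      simp [h1, h2, invX_inv, invY_inv, -MulAut.inv_apply]

theorem signs_le_normalizer : signs ≤ Subgroup.normalizer (innA : Set (MulAut F)) := by
  have hI : Inn ≤ innA := le_sup_left
  refine (Subgroup.closure_le _).2 ?_
  rintro _ (rfl | rfl)
  · refine mem_normalizer_of_sq_mem (by rw [invX_mul_self]; exact one_mem _)
      (conj_mem_of_mem_innA hI ?_ ?_)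
    · rw [invX_conj_alpha]
      exact inv_mem alpha_mem_innA
    · rw [invX_conj_beta]
      exact mul_mem (conj_mem_innA _) (inv_mem beta_mem_innA)
  · refine mem_normalizer_of_sq_mem (by rw [invY_mul_self]; exact one_mem _)
      (conj_mem_of_mem_innA hI ?_ ?_)
    · rw [invY_conj_alpha]
      exact mul_mem (conj_mem_innA _) (inv_mem alpha_mem_innA)
    · rw [invY_conj_beta]
      exact inv_mem beta_mem_innA

/-- Modulo four, the elements of `Inn(F₂) ⟨α, β⟩` have diagonal entries one and even off-diagonal
entries. -/
theorem abMatrixMod_four_of_mem_innA {σ : MulAut F} (hσ : σ ∈ innA) :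
    abMatrixMod 4 σ 0 0 = 1 ∧ abMatrixMod 4 σ 1 1 = 1 ∧ 2 * abMatrixMod 4 σ 0 1 = 0 ∧
      2 * abMatrixMod 4 σ 1 0 = 0 := by
  let T : Subgroup (MulAut F) :=
    { carrier := {σ | abMatrixMod 4 σ 0 0 = 1 ∧ abMatrixMod 4 σ 1 1 = 1 ∧
        2 * abMatrixMod 4 σ 0 1 = 0 ∧ 2 * abMatrixMod 4 σ 1 0 = 0}
      one_mem' := by simp
      mul_mem' := by
        rintro σ τ ⟨h1, h2, h3, h4⟩ ⟨h5, h6, h7, h8⟩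
        have key : ∀ b c : ZMod 4, 2 * b = 0 → 2 * c = 0 → b * c = 0 := by decide
        have hm (i j : Fin 2) : abMatrixMod 4 (σ * τ) i j =
            abMatrixMod 4 σ i 0 * abMatrixMod 4 τ 0 j +
              abMatrixMod 4 σ i 1 * abMatrixMod 4 τ 1 j := by
          rw [map_mul, Matrix.mul_apply, Fin.sum_univ_two]
        refine ⟨?_, ?_, ?_, ?_⟩
        · rw [hm, h1, h5, key _ _ h3 h8]; simp
        · rw [hm, h2, h6, key _ _ h4 h7]; simp
        · rw [hm, h1, h6, one_mul, mul_one, mul_add, h3, h7, add_zero]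
        · rw [hm, h2, h5, one_mul, mul_one, mul_add, h4, h8, add_zero]
      inv_mem' := by
        rintro σ ⟨h1, h2, h3, h4⟩
        -- the matrix of `σ` is an involution
        have hsq : abMatrixMod 4 σ * abMatrixMod 4 σ = 1 := by
          have key : ∀ b c : ZMod 4, 2 * b = 0 → 2 * c = 0 → b * c = 0 := by decide
          ext i j
          fin_cases i <;> fin_cases j <;>
            simp [Matrix.mul_apply, Fin.sum_univ_two, h1, h2, key _ _ h3 h4, key _ _ h4 h3,
              ← two_mul, h3, h4]
        have hinv : abMatrixMod 4 σ⁻¹ = abMatrixMod 4 σ := by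
          have : abMatrixMod 4 σ⁻¹ * abMatrixMod 4 σ = 1 := by
            rw [← map_mul, inv_mul_cancel, map_one]
          rw [← mul_one (abMatrixMod 4 σ⁻¹), ← hsq, ← mul_assoc, this, one_mul]
        simp only [Set.mem_ofPred_eq, hinv]
        exact ⟨h1, h2, h3, h4⟩ }
  refine (innA_le (T := T) ?_ ?_ ?_) hσ
  · rintro _ ⟨g, rfl⟩
    change _ ∧ _
    rw [abMatrixMod_conj]
    simp
  · change _ ∧ _
    rw [abMatrixMod_alpha]
    decide
  · change _ ∧ _
    rw [abMatrixMod_beta]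
    decide

open scoped Pointwise in
/-- An automorphism congruent to the identity modulo four is the product of an inner automorphism
and an element of `⟨α, β⟩`. -/
theorem exists_conj_mul_of_abMatrixMod_four {σ : MulAut F} (h : abMatrixMod 4 σ = 1) :
    ∃ (g : F) (τ : A), σ = MulAut.conj g * τ := by
  have h2 : σ ∈ levelTwo := by
    refine mem_levelTwo_of_abMatrixMod ?_
    have hmap : abMatrixMod 2 σ =
        (ZMod.castHom (by norm_num : 2 ∣ 4) (ZMod 2)).mapMatrix (abMatrixMod 4 σ) := by
      ext i j
      simp [abMatrixMod_apply]
    rw [hmap, h, map_one]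
  have h3 : σ ∈ (innA : Set (MulAut F)) * (signs : Set (MulAut F)) := by
    rwa [← Subgroup.coe_mul_of_right_le_normalizer_left _ _ signs_le_normalizer]
  obtain ⟨j, hj, d, hd, rfl⟩ := Set.mem_mul.1 h3
  -- a sign change is determined by its diagonal entries modulo four
  have hd1 : d = 1 := by
    obtain ⟨k1, k2, -, -⟩ := abMatrixMod_four_of_mem_innA hj
    have hm (i k : Fin 2) : abMatrixMod 4 (j * d) i k =
        abMatrixMod 4 j i 0 * abMatrixMod 4 d 0 k + abMatrixMod 4 j i 1 * abMatrixMod 4 d 1 k := by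
      rw [map_mul, Matrix.mul_apply, Fin.sum_univ_two]
    have m1 := hm 0 0
    have m2 := hm 1 1
    rw [h, k1] at m1
    rw [h, k2] at m2
    obtain ⟨hx, hy⟩ := signs_apply hd
    rw [abMatrixMod_eq 4 d] at m1 m2
    refine mulAut_ext ?_ ?_
    · refine hx.resolve_right fun hx => ?_
      simp [hx, expSum_inv, expSum_x] at m1
      revert m1; decide
    · refine hy.resolve_right fun hy => ?_
      simp [hy, expSum_inv, expSum_y] at m2
      revert m2; decide
  subst hd1
  have h4 : j ∈ (Inn : Set (MulAut F)) * (A : Set (MulAut F)) := by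
    rw [← Subgroup.normal_mul]; exact hj
  obtain ⟨_, ⟨g, rfl⟩, τ, hτ, rfl⟩ := Set.mem_mul.1 h4
  exact ⟨g, ⟨τ, hτ⟩, mul_one _⟩

end FreeTwo

namespace FreeTwo

/-! ### Fox derivatives modulo `N` and centralizers in `F₂ / N' Nᵖ` -/

section Fox

variable (N : Subgroup F) [N.Normal] (p : ℕ)

/-- A derivation of `F₂` with values in the functions on `F₂ / N` over `ℤ/pℤ`, on which `F₂` acts
by left translation. -/
def IsDerivation (D : F → F ⧸ N → ZMod p) : Prop :=
  ∀ g h t, D (g * h) t = D g t + D h ((g : F ⧸ N)⁻¹ * t)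

/-- The values of a derivation at the free generators can be prescribed. -/
theorem exists_isDerivation (φ ψ : F ⧸ N → ZMod p) :
    ∃ D : F → F ⧸ N → ZMod p, IsDerivation N p D ∧ D x = φ ∧ D y = ψ := by
  let f : F →* RegularWreathProduct (Multiplicative (ZMod p)) (F ⧸ N) :=
    FreeGroup.lift ![⟨fun t => Multiplicative.ofAdd (φ t), (x : F ⧸ N)⟩,
      ⟨fun t => Multiplicative.ofAdd (ψ t), (y : F ⧸ N)⟩]
  have hright (g : F) : (f g).right = (g : F ⧸ N) := by
    have h : RegularWreathProduct.rightHom.comp f = QuotientGroup.mk' N := by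
      refine FreeGroup.ext_hom _ _ fun i => ?_
      fin_cases i <;> simp [f] <;> rfl
    exact DFunLike.congr_fun h g
  refine ⟨fun g t => ((f g).left t).toAdd, ?_, ?_, ?_⟩
  · intro g h t
    simp [hright]
  · funext t
    simp [f, x]
  · funext t
    simp [f, y]

variable {N p} {D : F → F ⧸ N → ZMod p}

namespace IsDerivation

theorem map_one (hD : IsDerivation N p D) (t : F ⧸ N) : D 1 t = 0 := by
  have := hD 1 1 t
  simpa using this

theorem map_inv (hD : IsDerivation N p D) (g : F) (t : F ⧸ N) :
    D g⁻¹ t = -D g ((g : F ⧸ N) * t) := by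
  have := hD g⁻¹ g t
  rw [inv_mul_cancel, hD.map_one] at this
  rw [eq_neg_iff_add_eq_zero, this]
  simp

theorem map_mul_of_mem (hD : IsDerivation N p D) {g : F} (hg : g ∈ N) (h : F) (t : F ⧸ N) :
    D (g * h) t = D g t + D h t := by
  rw [hD, (QuotientGroup.eq_one_iff g).2 hg]
  simp

/-- On `N` a derivation is a homomorphism to an abelian group of exponent `p`. -/
theorem eq_zero_of_mem_derivedPow (hD : IsDerivation N p D) {q : F} (hq : q ∈ derivedPow N p) :
    q ∈ N ∧ ∀ t, D q t = 0 := by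
  let T : Subgroup F :=
    { carrier := {q | q ∈ N ∧ ∀ t, D q t = 0}
      one_mem' := ⟨N.one_mem, hD.map_one⟩
      mul_mem' := by
        rintro g h ⟨hg, hg'⟩ ⟨hh, hh'⟩
        exact ⟨N.mul_mem hg hh, fun t => by rw [hD.map_mul_of_mem hg, hg', hh', add_zero]⟩
      inv_mem' := by
        rintro g ⟨hg, hg'⟩
        exact ⟨N.inv_mem hg, fun t => by rw [hD.map_inv, hg', neg_zero]⟩ }
  refine (sup_le (c := T) ?_ ?_) hq
  · rw [Subgroup.commutator_le]
    intro g hg h hh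
    refine ⟨N.mul_mem (N.mul_mem (N.mul_mem hg hh) (N.inv_mem hg)) (N.inv_mem hh), fun t => ?_⟩
    have hinv {k : F} (hk : k ∈ N) : D k⁻¹ t = -D k t := by
      rw [hD.map_inv, (QuotientGroup.eq_one_iff k).2 hk, one_mul]
    rw [commutatorElement_def, hD.map_mul_of_mem (N.mul_mem (N.mul_mem hg hh) (N.inv_mem hg)),
      hD.map_mul_of_mem (N.mul_mem hg hh), hD.map_mul_of_mem hg, hinv hg, hinv hh]
    ring
  · rw [Subgroup.closure_le]
    rintro _ ⟨h, hh, rfl⟩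
    refine ⟨N.pow_mem hh p, fun t => ?_⟩
    have hpow (k : ℕ) : D (h ^ k) t = k * D h t := by
      induction k with
      | zero => simp [hD.map_one]
      | succ k ih => rw [pow_succ, hD.map_mul_of_mem (N.pow_mem hh k), ih]; push_cast; ring
    rw [hpow, CharP.cast_eq_zero, zero_mul]

/-- Fox calculus of a relation `g c = c g` modulo `N' Nᵖ`. -/
theorem of_commutator_mem (hD : IsDerivation N p D) {g c : F}
    (h : g * c * g⁻¹ * c⁻¹ ∈ derivedPow N p) (t : F ⧸ N) :
    D g t + D c ((g : F ⧸ N)⁻¹ * t) = D c t + D g ((c : F ⧸ N)⁻¹ * t) := by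
  obtain ⟨h1, h2⟩ := hD.eq_zero_of_mem_derivedPow h
  rw [← hD, ← hD, show g * c = g * c * g⁻¹ * c⁻¹ * (c * g) by group, hD.map_mul_of_mem h1, h2,
    zero_add]

end IsDerivation

/-- If the difference of a function along the translation by `s` is `δ_z - δ_1`, then the orbit of
`1` leads to `z`, and the function drops by one on the way. -/
theorem walk_of_difference {Γ R : Type*} [Group Γ] [Finite Γ] [DecidableEq Γ] [Ring R]
    [Nontrivial R] {s z : Γ} (hz : z ≠ 1) {w : Γ → R}
    (hw : ∀ t, w t + (if t = z then 1 else 0) = (if t = 1 then 1 else 0) + w (s⁻¹ * t)) :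
    (∃ k : ℕ, z = s⁻¹ ^ k) ∧ w z = w 1 - 1 := by
  have hex : ∃ k : ℕ, 0 < k ∧ (s⁻¹ ^ k = 1 ∨ s⁻¹ ^ k = z) :=
    ⟨orderOf s⁻¹, orderOf_pos _, Or.inl (pow_orderOf_eq_one _)⟩
  obtain ⟨hk0, hk⟩ := Nat.find_spec hex
  have hmin : ∀ j, 0 < j → j < Nat.find hex → s⁻¹ ^ j ≠ 1 ∧ s⁻¹ ^ j ≠ z := by
    intro j hj hjk
    have := Nat.find_min hex hjk
    simp only [not_and, not_or] at this
    exact this hj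
  have hval : ∀ j, 0 < j → j ≤ Nat.find hex → w (s⁻¹ ^ j) = w 1 - 1 := by
    intro j hj
    induction j, hj using Nat.le_induction with
    | base =>
      intro _
      have := hw 1
      rw [if_neg hz.symm, if_pos rfl, mul_one, add_zero] at this
      rw [Nat.succ_eq_add_one, zero_add, pow_one, this, add_sub_cancel_left]
    | succ j hj ih =>
      intro hle
      obtain ⟨h1, h2⟩ := hmin j hj (by omega)
      have := hw (s⁻¹ ^ j)
      rw [if_neg h1, if_neg h2, add_zero, zero_add, ← pow_succ'] at this
      rw [← this]
      exact ih (by omega)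
  have hend := hval _ hk0 le_rfl
  rcases hk with hk | hk
  · rw [hk] at hend
    exact absurd (sub_eq_self.1 hend.symm) one_ne_zero
  · rw [hk] at hend
    exact ⟨⟨_, hk.symm⟩, hend⟩

/-- An element which is central modulo `N' Nᵖ` lies in `N`. Otherwise, the derivative of `h` in the
direction of `x` would drop by one from `1` to `h` along the orbit of `x`, but `h` is also in the
orbit of `y`, along which that derivative is constant. -/
theorem mem_of_central_mod_derivedPow [Finite (F ⧸ N)] (hp : 1 < p) {h : F}
    (hx : h * x * h⁻¹ * x⁻¹ ∈ derivedPow N p) (hy : h * y * h⁻¹ * y⁻¹ ∈ derivedPow N p) :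
    h ∈ N := by
  classical
  have : Fact (1 < p) := ⟨hp⟩
  rw [← QuotientGroup.eq_one_iff]
  by_contra hz
  have hδ (t : F ⧸ N) : ((h : F ⧸ N)⁻¹ * t = 1) = (t = (h : F ⧸ N)) := by
    rw [inv_mul_eq_one]
    exact propext eq_comm
  obtain ⟨D, hD, hDx, hDy⟩ := exists_isDerivation N p (fun t => if t = 1 then 1 else 0) 0
  have h1 := hD.of_commutator_mem hx
  have h2 := hD.of_commutator_mem hy
  simp only [hDx, hDy, hδ, Pi.zero_apply, add_zero, zero_add] at h1 h2
  obtain ⟨E, hE, hEx, hEy⟩ := exists_isDerivation N p 0 (fun t => if t = 1 then 1 else 0)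
  have h3 := hE.of_commutator_mem hy
  simp only [hEy, hδ] at h3
  obtain ⟨-, hdrop⟩ := walk_of_difference hz h1
  obtain ⟨⟨k, hk⟩, -⟩ := walk_of_difference hz h3
  have hconst : ∀ k : ℕ, D h ((y : F ⧸ N)⁻¹ ^ k) = D h 1 := by
    intro k
    induction k with
    | zero => simp
    | succ k ih => rw [pow_succ', ← h2, ih]
  rw [hk, hconst] at hdrop
  exact absurd (sub_eq_self.1 hdrop.symm) one_ne_zero

/-- An element commuting with `[y, x]` modulo `N' Nᵖ` is a power of `[y, x]` modulo `N`.
Topologically: the boundary components of the covering of the punctured torus that belongs to `N`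
are distinct in homology with coefficients modulo an odd prime. -/
theorem mem_zpowers_of_commute_mod_derivedPow [Finite (F ⧸ N)] (hp : p.Prime) (hp2 : p ≠ 2)
    {g : F} (h : g * (y * x * y⁻¹ * x⁻¹) * g⁻¹ * (y * x * y⁻¹ * x⁻¹)⁻¹ ∈ derivedPow N p) :
    ∃ k : ℤ, (g : F ⧸ N) = ((y * x * y⁻¹ * x⁻¹ : F) : F ⧸ N) ^ k := by
  classical
  have : Fact p.Prime := ⟨hp⟩
  have : Fintype (F ⧸ N) := Fintype.ofFinite _
  set c : F := y * x * y⁻¹ * x⁻¹ with hc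
  let X : F ⧸ N := (x : F ⧸ N)
  let Y : F ⧸ N := (y : F ⧸ N)
  let C : F ⧸ N := (c : F ⧸ N)
  have hC : C = Y * X * Y⁻¹ * X⁻¹ := rfl
  let I : F ⧸ N → ZMod p := fun t => if t ∈ Subgroup.zpowers C then 1 else 0
  let f : F ⧸ N → ZMod p := fun t => I ((g : F ⧸ N) * t) - I t
  -- summation over the cosets of `⟨c⟩` kills the unknown derivative of `g`
  have key (D : F → F ⧸ N → ZMod p) (hD : IsDerivation N p D) (a b : F ⧸ N)
      (hDc : ∀ t, D c t = (if t = a then 1 else 0) - (if t = b then 1 else 0)) (s : F ⧸ N) :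
      f (a * s) = f (b * s) := by
    have hsum := fun k : Subgroup.zpowers C => hD.of_commutator_mem h ((k : F ⧸ N) * s⁻¹)
    have htot := Finset.sum_congr (rfl : (Finset.univ : Finset (Subgroup.zpowers C)) = _)
      fun k _ => hsum k
    rw [Finset.sum_add_distrib, Finset.sum_add_distrib] at htot
    have hshift : ∑ k : Subgroup.zpowers C, D g (C⁻¹ * ((k : F ⧸ N) * s⁻¹)) =
        ∑ k : Subgroup.zpowers C, D g ((k : F ⧸ N) * s⁻¹) := by
      refine Fintype.sum_equiv (Equiv.mulLeft ⟨C⁻¹, inv_mem (Subgroup.mem_zpowers C)⟩) _ _ ?_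
      intro k
      simp [mul_assoc]
    have hI (d : F ⧸ N) : ∑ k : Subgroup.zpowers C,
        (if (k : F ⧸ N) * s⁻¹ = d then (1 : ZMod p) else 0) = I (d * s) := by
      by_cases hd : d * s ∈ Subgroup.zpowers C
      · rw [Finset.sum_eq_single ⟨d * s, hd⟩]
        · simp [I, hd]
        · rintro ⟨k, hk⟩ - hne
          rw [if_neg]
          rintro rfl
          exact hne (by simp)
        · simp
      · rw [Finset.sum_eq_zero]
        · simp [I, hd]
        · rintro ⟨k, hk⟩ -
          rw [if_neg]
          rintro rfl
          exact hd (by simpa using hk)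
    have hg (k d : F ⧸ N) : ((g : F ⧸ N)⁻¹ * k = d) = (k = (g : F ⧸ N) * d) := by
      rw [inv_mul_eq_iff_eq_mul]
    rw [hshift] at htot
    simp only [hDc, Finset.sum_sub_distrib, hg, hI] at htot
    simp only [f, ← mul_assoc]
    linear_combination htot
  have e1 : ∀ s, f (Y * s) = f (C * s) := by
    obtain ⟨D, hD, hDx, hDy⟩ := exists_isDerivation N p (fun t => if t = 1 then 1 else 0) 0
    refine key D hD Y C fun t => ?_
    have i1 : ((Y : F ⧸ N)⁻¹ * t = 1) = (t = Y) := by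
      rw [inv_mul_eq_one]
      exact propext eq_comm
    have i2 : (X * ((Y * X * Y⁻¹)⁻¹ * t) = 1) = (t = C) := by
      rw [hC, ← mul_assoc, mul_eq_one_iff_inv_eq]
      simp only [mul_inv_rev, inv_inv, mul_assoc]
      exact propext eq_comm
    rw [hc, hD, hD, hD, hD.map_inv, hD.map_inv, hDx, hDy]
    simp only [QuotientGroup.mk_mul, QuotientGroup.mk_inv, Pi.zero_apply]
    change _ + (if Y⁻¹ * t = 1 then _ else _) + _ + -(if X * ((Y * X * Y⁻¹)⁻¹ * t) = 1 then _ else _)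
      = _
    simp only [i1, i2]
    ring
  have e2 : ∀ s, f (1 * s) = f (Y * X * Y⁻¹ * s) := by
    obtain ⟨D, hD, hDx, hDy⟩ := exists_isDerivation N p 0 (fun t => if t = 1 then 1 else 0)
    refine key D hD 1 (Y * X * Y⁻¹) fun t => ?_
    have i2 : (Y * ((Y * X)⁻¹ * t) = 1) = (t = Y * X * Y⁻¹) := by
      rw [← mul_assoc, mul_eq_one_iff_inv_eq]
      simp only [mul_inv_rev, inv_inv, mul_assoc]
      exact propext eq_comm
    rw [hc, hD, hD, hD, hD.map_inv, hD.map_inv, hDx, hDy]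
    simp only [QuotientGroup.mk_mul, Pi.zero_apply]
    change _ + _ + -(if Y * ((Y * X)⁻¹ * t) = 1 then _ else _) + _ = _
    simp only [i2]
    ring
  let S : Subgroup (F ⧸ N) :=
    { carrier := {w | ∀ s, f (w * s) = f s}
      one_mem' := fun s => by rw [one_mul]
      mul_mem' := fun {v w} hv hw s => by rw [mul_assoc, hv, hw]
      inv_mem' := fun {w} hw s => by rw [← hw (w⁻¹ * s), mul_inv_cancel_left] }
  have s1 : C * Y⁻¹ ∈ S := fun s => by
    rw [mul_assoc, ← e1, mul_inv_cancel_left]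
  have s2 : Y * X * Y⁻¹ ∈ S := fun s => by rw [← e2, one_mul]
  have s3 : Y * X ∈ S := by
    have := S.mul_mem (S.inv_mem s1) s2
    have he : (C * Y⁻¹)⁻¹ * (Y * X * Y⁻¹) = Y * X := by rw [hC]; group
    rwa [he] at this
  have s4 : Y ∈ S := by
    have := S.mul_mem (S.inv_mem s2) s3
    have he : (Y * X * Y⁻¹)⁻¹ * (Y * X) = Y := by group
    rwa [he] at this
  have s5 : X ∈ S := by
    have := S.mul_mem (S.inv_mem s4) s3
    rwa [inv_mul_cancel_left] at this
  have htop : ∀ w : F, (w : F ⧸ N) ∈ S := by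
    intro w
    induction w using FreeGroup.induction_on with
    | C1 => exact S.one_mem
    | of k => fin_cases k; exacts [s5, s4]
    | inv_of k hk => exact S.inv_mem hk
    | mul u v hu hv => exact S.mul_mem hu hv
  have hfin := htop g⁻¹ 1
  rw [mul_one] at hfin
  by_contra hg
  have hgC : (g : F ⧸ N) ∉ Subgroup.zpowers C := by
    rintro ⟨k, hk⟩
    exact hg ⟨k, hk.symm⟩
  have hgC' : ((g⁻¹ : F) : F ⧸ N) ∉ Subgroup.zpowers C := by
    rw [QuotientGroup.mk_inv, inv_mem_iff]
    exact hgC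
  simp only [f, I, hgC, hgC', mul_one, if_false] at hfin
  rw [QuotientGroup.mk_inv, mul_inv_cancel, if_pos (one_mem _)] at hfin
  have h2 : ((2 : ℕ) : ZMod p) = 0 := by push_cast; linear_combination hfin
  rw [ZMod.natCast_eq_zero_iff] at h2
  exact hp2 ((Nat.prime_dvd_prime_iff_eq hp Nat.prime_two).1 h2)

end Fox

end FreeTwo

/-- For a normal subgroup, the relative index grows with the second subgroup. -/
theorem Subgroup.relIndex_dvd_of_le_right {G : Type*} [Group G] (H : Subgroup G) [H.Normal]
    {K L : Subgroup G} (h : K ≤ L) : H.relIndex K ∣ H.relIndex L := by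
  rw [← QuotientGroup.ker_mk' H, Subgroup.relIndex_ker, Subgroup.relIndex_ker]
  exact Subgroup.card_dvd_of_le (Subgroup.map_mono h)

namespace FreeTwo

open scoped commutatorElement

/-! ### The index of `N' Nᵖ` in `N` -/

section Schreier

variable (N : Subgroup F) [N.Normal]

theorem out_mul_mul_out_inv_mem (t : F ⧸ N) (w : F) :
    t.out * w * (t * (w : F ⧸ N)).out⁻¹ ∈ N := by
  rw [← QuotientGroup.eq_one_iff]
  simp

/-- The element of `N` that belongs to the coset `t` and the word `w`, for the transversal
`Quotient.out`. For a generator `w` it is a Schreier generator. -/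
noncomputable def schreierElt (t : F ⧸ N) (w : F) : N :=
  ⟨t.out * w * (t * (w : F ⧸ N)).out⁻¹, out_mul_mul_out_inv_mem N t w⟩

theorem schreierElt_mul (t : F ⧸ N) (v w : F) :
    schreierElt N t (v * w) = schreierElt N t v * schreierElt N (t * (v : F ⧸ N)) w := by
  apply Subtype.ext
  simp [schreierElt, mul_assoc]

theorem schreierElt_one (t : F ⧸ N) : schreierElt N t 1 = 1 := by
  apply Subtype.ext
  simp [schreierElt]

variable (p : ℕ)

/-- The values of a homomorphism `N → ℤ/pℤ` on the Schreier generators, plus the coboundary of a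
function on `F₂ / N`. -/
noncomputable def schreierMap : (Additive N →+ ZMod p) × (F ⧸ N → ZMod p) →ₗ[ZMod p]
    ((F ⧸ N) × Fin 2 → ZMod p) where
  toFun u := fun s => u.1 (Additive.ofMul (schreierElt N s.1 (FreeGroup.of s.2))) +
    (u.2 (s.1 * (FreeGroup.of s.2 : F)) - u.2 s.1)
  map_add' u v := by
    funext s
    simp only [Prod.fst_add, Prod.snd_add, AddMonoidHom.add_apply, Pi.add_apply]
    ring
  map_smul' c u := by
    funext s
    simp only [Prod.smul_fst, Prod.smul_snd, AddMonoidHom.smul_apply, Pi.smul_apply, smul_eq_mul,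
      RingHom.id_apply]
    ring

variable {N p}

/-- A relation on the Schreier generators propagates to all words, since `schreierElt` is a
cocycle. -/
theorem eq_of_schreierMap_eq_zero {u : (Additive N →+ ZMod p) × (F ⧸ N → ZMod p)}
    (hu : schreierMap N p u = 0) : u.1 = 0 ∧ ∀ t, u.2 t = u.2 1 := by
  obtain ⟨f, φ⟩ := u
  have key : ∀ (w : F) (t : F ⧸ N),
      f (Additive.ofMul (schreierElt N t w)) + (φ (t * (w : F ⧸ N)) - φ t) = 0 := by
    intro w
    have hinv : ∀ v : F, (∀ t : F ⧸ N,
        f (Additive.ofMul (schreierElt N t v)) + (φ (t * (v : F ⧸ N)) - φ t) = 0) →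
        ∀ t : F ⧸ N,
          f (Additive.ofMul (schreierElt N t v⁻¹)) + (φ (t * ((v⁻¹ : F) : F ⧸ N)) - φ t) = 0 := by
      intro v hv t
      have h1 := hv (t * ((v⁻¹ : F) : F ⧸ N))
      have h2 := schreierElt_mul N t v⁻¹ v
      rw [inv_mul_cancel, schreierElt_one] at h2
      have h3 := congrArg (fun n => f (Additive.ofMul n)) h2
      simp only [ofMul_mul, map_add, ofMul_one, map_zero] at h3
      rw [QuotientGroup.mk_inv, inv_mul_cancel_right] at h1
      rw [QuotientGroup.mk_inv] at h3 ⊢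
      linear_combination -h3 - h1
    induction w using FreeGroup.induction_on with
    | C1 =>
      intro t
      simp [schreierElt_one]
    | of i => exact fun t => congrFun hu (t, i)
    | inv_of i hi => exact hinv _ hi
    | mul v w hv hw =>
      intro t
      have h1 := hv t
      have h2 := hw (t * (v : F ⧸ N))
      rw [schreierElt_mul, ofMul_mul, map_add, QuotientGroup.mk_mul, ← mul_assoc]
      linear_combination h1 + h2
  have hf : f = 0 := by
    refine AddMonoidHom.ext fun n => ?_
    obtain ⟨n, rfl⟩ := Additive.ofMul.surjective n
    have h1 := key n 1
    rw [(QuotientGroup.eq_one_iff (n : F)).2 n.2, mul_one, sub_self, add_zero] at h1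
    have hs : ((1 : F ⧸ N).out : F) ∈ N := by
      rw [← QuotientGroup.eq_one_iff]; simp
    have h2 : schreierElt N 1 (n : F) = ⟨_, hs⟩ * n * ⟨_, hs⟩⁻¹ := by
      apply Subtype.ext
      simp [schreierElt, (QuotientGroup.eq_one_iff (n : F)).2 n.2]
    rw [h2, ofMul_mul, ofMul_mul, ofMul_inv, map_add, map_add, map_neg, add_neg_eq_zero] at h1
    have h3 : f (Additive.ofMul n) = 0 := by
      simpa using h1
    simpa using h3
  refine ⟨hf, fun t => ?_⟩
  obtain ⟨w, rfl⟩ := QuotientGroup.mk_surjective t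
  have h1 := key w 1
  rw [show f = 0 from hf, AddMonoidHom.zero_apply, zero_add, one_mul, sub_eq_zero] at h1
  exact h1

/-- The kernel of `schreierMap` consists of the constant functions, and the target has dimension
`2 [F₂ : N]`. -/
theorem finite_and_finrank_addMonoidHom_le [Finite (F ⧸ N)] [Fact p.Prime] :
    Module.Finite (ZMod p) (Additive N →+ ZMod p) ∧
      Module.finrank (ZMod p) (Additive N →+ ZMod p) ≤ N.index + 1 := by
  have : Fintype (F ⧸ N) := Fintype.ofFinite _
  have hfin : Module.Finite (ZMod p) (Additive N →+ ZMod p) := by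
    refine Module.Finite.of_injective ((schreierMap N p).comp (LinearMap.inl _ _ _)) ?_
    rw [← LinearMap.ker_eq_bot, LinearMap.ker_eq_bot']
    exact fun f hf => (eq_of_schreierMap_eq_zero hf).1
  refine ⟨hfin, ?_⟩
  have h1 := (schreierMap N p).finrank_range_add_finrank_ker
  have h2 : Module.finrank (ZMod p) (schreierMap N p).ker ≤ 1 := by
    let ev : (schreierMap N p).ker →ₗ[ZMod p] ZMod p :=
      ((LinearMap.proj (1 : F ⧸ N)).comp (LinearMap.snd _ _ _)).comp (schreierMap N p).ker.subtype
    have hev : Function.Injective ev := by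
      rw [← LinearMap.ker_eq_bot, LinearMap.ker_eq_bot']
      rintro ⟨⟨f, φ⟩, hu⟩ h
      obtain ⟨h3, h4⟩ := eq_of_schreierMap_eq_zero hu
      refine Subtype.ext (Prod.ext h3 (funext fun t => ?_))
      exact (h4 t).trans h
    have := LinearMap.finrank_le_finrank_of_injective hev
    rwa [Module.finrank_self] at this
  have h3 := Submodule.finrank_le (schreierMap N p).range
  rw [Module.finrank_prod, Module.finrank_fintype_fun_eq_card] at h1
  rw [Module.finrank_fintype_fun_eq_card, Fintype.card_prod, Fintype.card_fin] at h3
  rw [Subgroup.index_eq_card, Nat.card_eq_fintype_card]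
  omega

theorem derivedPow_normal (m : ℕ) : (derivedPow N m).Normal := by
  have h : (Subgroup.closure {g | ∃ h ∈ N, h ^ m = g}).Normal := by
    refine ⟨fun n hn g => ?_⟩
    have hle : Subgroup.closure {g | ∃ h ∈ N, h ^ m = g} ≤
        (Subgroup.closure {g | ∃ h ∈ N, h ^ m = g}).comap (MulAut.conj g).toMonoidHom := by
      rw [Subgroup.closure_le]
      rintro _ ⟨h, hh, rfl⟩
      refine Subgroup.subset_closure ⟨g * h * g⁻¹, Subgroup.Normal.conj_mem ‹_› h hh g, ?_⟩
      simp
    exact hle hn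
  exact Subgroup.sup_normal _ _

theorem commutator_le_derivedPow (L : Subgroup F) (m : ℕ) : ⁅L, L⁆ ≤ derivedPow L m := le_sup_left

theorem pow_mem_derivedPow {L : Subgroup F} {g : F} (hg : g ∈ L) (m : ℕ) :
    g ^ m ∈ derivedPow L m :=
  Subgroup.mem_sup_right (Subgroup.subset_closure ⟨g, hg, rfl⟩)

theorem derivedPow_le (L : Subgroup F) (m : ℕ) : derivedPow L m ≤ L := by
  refine sup_le (Subgroup.commutator_le.2 fun g hg h hh => ?_) ((Subgroup.closure_le _).2 ?_)
  · exact L.mul_mem (L.mul_mem (L.mul_mem hg hh) (L.inv_mem hg)) (L.inv_mem hh)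
  · rintro _ ⟨h, hh, rfl⟩
    exact L.pow_mem hh m

/-- A vector space over `ℤ/pℤ` that is a quotient of `G` is no larger than the space of
homomorphisms from `G` to `ℤ/pℤ`. -/
theorem natCard_dvd_of_surjective [Fact p.Prime] {G V : Type*} [AddGroup G] [AddCommGroup V]
    [Module (ZMod p) V] (q : G →+ V) (hq : Function.Surjective q) {d : ℕ}
    [Module.Finite (ZMod p) (G →+ ZMod p)] (hd : Module.finrank (ZMod p) (G →+ ZMod p) ≤ d) :
    Nat.card V ∣ p ^ d := by
  let pull : Module.Dual (ZMod p) V →ₗ[ZMod p] (G →+ ZMod p) :=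
    { toFun := fun l => l.toAddMonoidHom.comp q
      map_add' := fun _ _ => rfl
      map_smul' := fun _ _ => rfl }
  have hpull : Function.Injective pull := by
    intro l l' h
    refine LinearMap.ext fun u => ?_
    obtain ⟨u, rfl⟩ := hq u
    exact DFunLike.congr_fun h u
  have hdual : Module.Finite (ZMod p) (Module.Dual (ZMod p) V) :=
    Module.Finite.of_injective pull hpull
  have hV : Module.Finite (ZMod p) V := Module.finite_dual_iff (ZMod p) |>.1 hdual
  rw [Module.natCard_eq_pow_finrank (K := ZMod p), Nat.card_zmod]
  refine pow_dvd_pow p ?_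
  rw [← Subspace.dual_finrank_eq]
  exact (LinearMap.finrank_le_finrank_of_injective hpull).trans hd

/-- Half of Schreier's index formula, in homology modulo `p`: the dimension of `N / N' Nᵖ` is at
most `[F₂ : N] + 1`. -/
theorem relIndex_derivedPow_dvd [Finite (F ⧸ N)] (hp : p.Prime) :
    (derivedPow N p).relIndex N ∣ p ^ (N.index + 1) := by
  have : Fact p.Prime := ⟨hp⟩
  have := derivedPow_normal (N := N) p
  obtain ⟨hfin, hrank⟩ := finite_and_finrank_addMonoidHom_le (N := N) (p := p)
  let Q := N ⧸ (derivedPow N p).subgroupOf N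
  let _ : CommGroup Q :=
    { mul_comm := by
        intro u v
        obtain ⟨u, rfl⟩ := QuotientGroup.mk_surjective u
        obtain ⟨v, rfl⟩ := QuotientGroup.mk_surjective v
        refine QuotientGroup.eq.2 (Subgroup.mem_subgroupOf.2 ?_)
        have : ((u * v)⁻¹ * (v * u) : N) = ⁅v⁻¹, u⁻¹⁆ := by
          simp [commutatorElement_def, mul_assoc]
        rw [this]
        exact commutator_le_derivedPow N p (Subgroup.commutator_mem_commutator
          (N.inv_mem v.2) (N.inv_mem u.2)) }
  let _ : Module (ZMod p) (Additive Q) := AddCommGroup.zmodModule (n := p) <| by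
    intro u
    obtain ⟨u, rfl⟩ := Additive.ofMul.surjective u
    obtain ⟨u, rfl⟩ := QuotientGroup.mk_surjective u
    rw [← ofMul_pow, ← QuotientGroup.mk_pow, ofMul_eq_zero, QuotientGroup.eq_one_iff,
      Subgroup.mem_subgroupOf]
    exact pow_mem_derivedPow u.2 p
  have := natCard_dvd_of_surjective (p := p)
    (MonoidHom.toAdditive (QuotientGroup.mk' ((derivedPow N p).subgroupOf N)) :
      Additive N →+ Additive Q)
    (QuotientGroup.mk'_surjective ((derivedPow N p).subgroupOf N)) hrank
  exact this

end Schreier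

/-! ### The index of `M` -/

theorem mem_derivedPow_top (m : ℕ) (w : F) :
    w ∈ derivedPow ⊤ m ↔ ∀ i, (m : ℤ) ∣ expSum i w := by
  constructor
  · intro hw i
    let T : Subgroup F := ((Subgroup.zpowers (Multiplicative.ofAdd (m : ℤ))).comap (expHom i))
    have hT : derivedPow ⊤ m ≤ T := by
      refine sup_le (Subgroup.commutator_le.2 fun g _ h _ => ?_) ((Subgroup.closure_le _).2 ?_)
      · change expHom i ⁅g, h⁆ ∈ Subgroup.zpowers (Multiplicative.ofAdd (m : ℤ))
        rw [map_commutatorElement, commutatorElement_eq_one_iff_mul_comm.2 (mul_comm _ _)]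
        exact one_mem _
      · rintro _ ⟨h, -, rfl⟩
        refine ⟨expSum i h, Multiplicative.toAdd.injective ?_⟩
        change expSum i h * (m : ℤ) = expSum i (h ^ m)
        rw [expSum_pow, mul_comm]
    obtain ⟨k, hk⟩ := hT hw
    refine ⟨k, ?_⟩
    have := congrArg Multiplicative.toAdd hk
    simpa [mul_comm, expSum] using this.symm
  · intro h
    have := derivedPow_normal (N := ⊤) m
    let q := QuotientGroup.mk' (derivedPow ⊤ m)
    have hcomm (u v : F) : q u * q v = q v * q u := by
      rw [← map_mul, ← map_mul]
      refine QuotientGroup.eq.2 ?_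
      have : ((u * v)⁻¹ * (v * u)) = ⁅v⁻¹, u⁻¹⁆ := by
        simp [commutatorElement_def, mul_assoc]
      rw [this]
      exact commutator_le_derivedPow ⊤ m
        (Subgroup.commutator_mem_commutator (Subgroup.mem_top _) (Subgroup.mem_top _))
    have key (w : F) : q w = q x ^ expSum 0 w * q y ^ expSum 1 w := by
      induction w using FreeGroup.induction_on with
      | C1 => simp [expSum_one]
      | of i =>
        fin_cases i
        · change q x = q x ^ expSum 0 x * q y ^ expSum 1 x
          simp [expSum_x]
        · change q y = q x ^ expSum 0 y * q y ^ expSum 1 y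
          simp [expSum_y]
      | inv_of i hi =>
        rw [map_inv, hi, expSum_inv, expSum_inv, zpow_neg, zpow_neg, mul_inv_rev]
        exact ((Commute.zpow_zpow (hcomm x y) _ _).inv_inv).symm
      | mul u v hu hv =>
        rw [map_mul, hu, hv, expSum_mul, expSum_mul, zpow_add, zpow_add, mul_assoc, mul_assoc]
        congr 1
        rw [← mul_assoc, ← mul_assoc]
        congr 1
        exact (Commute.zpow_zpow (hcomm x y) _ _).symm
    have hm (u : F) {k : ℤ} (hk : (m : ℤ) ∣ k) : q u ^ k = 1 := by
      obtain ⟨k, rfl⟩ := hk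
      rw [mul_comm, zpow_mul, zpow_natCast, ← map_zpow, ← map_pow]
      exact (QuotientGroup.eq_one_iff _).2 (pow_mem_derivedPow (Subgroup.mem_top _) m)
    refine (QuotientGroup.eq_one_iff w).1 ((key w).trans ?_)
    rw [hm x (h 0), hm y (h 1), one_mul]

theorem index_derivedPow_top (m : ℕ) : (derivedPow ⊤ m).index = m ^ 2 := by
  let c : Multiplicative ℤ →* Multiplicative (ZMod m) :=
    AddMonoidHom.toMultiplicative (Int.castAddHom (ZMod m))
  let f : F →* Multiplicative (ZMod m) × Multiplicative (ZMod m) :=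
    (c.comp (expHom 0)).prod (c.comp (expHom 1))
  have hf (w : F) : f w = (Multiplicative.ofAdd (expSum 0 w : ZMod m),
    Multiplicative.ofAdd (expSum 1 w : ZMod m)) := rfl
  have hker : f.ker = derivedPow ⊤ m := by
    ext w
    rw [mem_derivedPow_top, MonoidHom.mem_ker, hf, Fin.forall_fin_two,
      ← ZMod.intCast_zmod_eq_zero_iff_dvd, ← ZMod.intCast_zmod_eq_zero_iff_dvd]
    simp [Prod.ext_iff]
  have hsurj : Function.Surjective f := by
    rintro ⟨u, v⟩
    obtain ⟨i, hi⟩ := ZMod.intCast_surjective u.toAdd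
    obtain ⟨j, hj⟩ := ZMod.intCast_surjective v.toAdd
    refine ⟨x ^ i * y ^ j, ?_⟩
    rw [map_mul, map_zpow, map_zpow, hf, hf]
    simp [expSum_x, expSum_y, ← ofAdd_zsmul, hi, hj]
  rw [← hker, Subgroup.index_ker, MonoidHom.range_eq_top.2 hsurj]
  rw [Nat.card_congr Subgroup.topEquiv.toEquiv, Nat.card_prod, pow_two,
    Nat.card_congr (Multiplicative.toAdd (α := ZMod m)), Nat.card_zmod]

end FreeTwo

namespace FreeTwo

theorem relIndex_A_dvd {H : Subgroup (MulAut F)} [H.Normal] :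
    (H.subgroupOf A).index ∣ H.relIndex AutPrime := by
  refine Subgroup.relIndex_dvd_of_le_right H ((Subgroup.closure_le _).2 ?_)
  rintro _ (rfl | rfl)
  · change toGL alpha ∈ Subgroup.closure {matA, matB}
    rw [toGL_alpha]
    exact Subgroup.subset_closure (by simp)
  · change toGL beta ∈ Subgroup.closure {matA, matB}
    rw [toGL_beta]
    exact Subgroup.subset_closure (by simp)

theorem mem_preK {H : Subgroup (MulAut F)} {w : F} :
    w ∈ preK H ↔ ∃ hw : w ∈ Delta, (piHom ⟨w, hw⟩ : MulAut F) ∈ H := by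
  constructor
  · rintro ⟨d, hd, rfl⟩
    exact ⟨d.2, hd⟩
  · rintro ⟨hw, h⟩
    exact ⟨⟨w, hw⟩, h, rfl⟩

theorem preK_le_Delta (H : Subgroup (MulAut F)) : preK H ≤ Delta := fun _ h => (mem_preK.1 h).1

instance delta_normal : Delta.Normal := inferInstanceAs modTwo.ker.Normal

theorem exists_coset_rep (g : F) : ∃ t : Fin 4, g * (![1, x, y, x * y] t)⁻¹ ∈ Delta := by
  have h : ∀ v : V4, ∃ t : Fin 4, v = modTwo (![1, x, y, x * y] t) := by
    have h1 : ∀ v : V4, v = 1 ∨ v = Multiplicative.ofAdd (1, 0) ∨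
      v = Multiplicative.ofAdd (0, 1) ∨
      v = Multiplicative.ofAdd (1, 0) * Multiplicative.ofAdd (0, 1) := by decide
    intro v
    rcases h1 v with rfl | rfl | rfl | rfl
    · exact ⟨0, by simp⟩
    · exact ⟨1, by simp [modTwo, x]⟩
    · exact ⟨2, by simp [modTwo, y]⟩
    · exact ⟨3, by simp [modTwo, x, y]⟩
  obtain ⟨t, ht⟩ := h (modTwo g)
  refine ⟨t, ?_⟩
  rw [Delta, MonoidHom.mem_ker, map_mul, map_inv, ← ht, mul_inv_cancel]

/-- As `Δ` normalizes `π⁻¹(K)`, its core is the intersection of the four conjugates by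
representatives of `F₂ / Δ`. -/
theorem relIndex_normalCore_preK_dvd {H : Subgroup (MulAut F)} [H.Normal] :
    (preK H).normalCore.relIndex Delta ∣ (H.subgroupOf A).index ^ 4 := by
  let f : Delta →* (Fin 4 → A ⧸ H.subgroupOf A) := MonoidHom.pi fun t =>
    (QuotientGroup.mk' (H.subgroupOf A)).comp
      (piHom.comp (MulAut.conjNormal (![1, x, y, x * y] t)).toMonoidHom)
  have hf : f.ker ≤ (preK H).normalCore.subgroupOf Delta := by
    intro d hd g
    obtain ⟨t, ht⟩ := exists_coset_rep g
    have h1 : piHom (MulAut.conjNormal (![1, x, y, x * y] t) d) ∈ H.subgroupOf A :=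
      (QuotientGroup.eq_one_iff _).1 (congrFun hd t)
    set s : F := ![1, x, y, x * y] t
    have h2 : piHom (⟨g * s⁻¹, ht⟩ * MulAut.conjNormal s d * ⟨g * s⁻¹, ht⟩⁻¹) ∈
        H.subgroupOf A := by
      rw [map_mul, map_mul, map_inv]
      exact Subgroup.Normal.conj_mem inferInstance _ h1 _
    refine ⟨_, h2, ?_⟩
    simp [mul_assoc]
  have h1 := Subgroup.index_dvd_of_le hf
  rw [Subgroup.index_ker] at h1
  refine h1.trans ((Subgroup.card_subgroup_dvd_card _).trans ?_)
  rw [Nat.card_fun, Nat.card_fin, Subgroup.index_eq_card]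

theorem derivedPow_top_mono {k m : ℕ} (h : k ∣ m) : derivedPow ⊤ m ≤ derivedPow ⊤ k := by
  intro w hw
  rw [mem_derivedPow_top] at hw ⊢
  exact fun i => (Int.natCast_dvd_natCast.2 h).trans (hw i)

theorem derivedPow_top_two_le_Delta : derivedPow ⊤ 2 ≤ Delta := by
  refine sup_le (Subgroup.commutator_le.2 fun g _ h _ => ?_) ((Subgroup.closure_le _).2 ?_)
  · rw [Delta, MonoidHom.mem_ker, map_commutatorElement,
      commutatorElement_eq_one_iff_mul_comm.2 (mul_comm _ _)]
  · rintro _ ⟨h, -, rfl⟩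
    have key : ∀ v : V4, v ^ 2 = 1 := by decide
    change modTwo (h ^ 2) = 1
    rw [map_pow, key]

theorem explicitN_le_Delta (H : Subgroup (MulAut F)) : explicitN H ≤ Delta :=
  inf_le_right.trans ((Subgroup.normalCore_le _).trans (preK_le_Delta H))

instance explicitN_normal (H : Subgroup (MulAut F)) : (explicitN H).Normal :=
  have := derivedPow_normal (N := ⊤) 6
  Subgroup.normal_inf_normal _ _

theorem index_explicitN_dvd {H : Subgroup (MulAut F)} [H.Normal] :
    (explicitN H).index ∣ 36 * H.relIndex AutPrime ^ 4 := by
  have h1 : (explicitN H).relIndex (derivedPow ⊤ 6) * (derivedPow ⊤ 6).index =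
      (explicitN H).index := Subgroup.relIndex_mul_index inf_le_left
  have h2 : (explicitN H).relIndex (derivedPow ⊤ 6) =
      (preK H).normalCore.relIndex (derivedPow ⊤ 6) := Subgroup.inf_relIndex_left _ _
  rw [← h1, h2, index_derivedPow_top, mul_comm]
  refine mul_dvd_mul (by norm_num) ?_
  refine (Subgroup.relIndex_dvd_of_le_right _
    ((derivedPow_top_mono (by norm_num : 2 ∣ 6)).trans derivedPow_top_two_le_Delta)).trans ?_
  exact relIndex_normalCore_preK_dvd.trans (pow_dvd_pow_of_dvd relIndex_A_dvd 4)

theorem explicitM_normal (H : Subgroup (MulAut F)) (p : ℕ) : (explicitM H p).Normal :=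
  have := derivedPow_normal (N := ⊤) 4
  have := derivedPow_normal (N := explicitN H) p
  Subgroup.normal_inf_normal _ _

theorem index_explicitM_dvd {H : Subgroup (MulAut F)} [H.Normal] {n : ℕ}
    (hn : n = H.relIndex AutPrime) (hn0 : n ≠ 0) {p : ℕ} (hp : p.Prime) :
    (explicitM H p).index ∣ 144 * n ^ 4 * p ^ (36 * n ^ 4 + 1) := by
  have hN : (explicitN H).index ∣ 36 * n ^ 4 := hn ▸ index_explicitN_dvd
  have hpos : 36 * n ^ 4 ≠ 0 := by positivity
  have hfin : (explicitN H).FiniteIndex := ⟨ne_zero_of_dvd_ne_zero hpos hN⟩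
  have hL : (derivedPow (explicitN H) p).index ∣ p ^ (36 * n ^ 4 + 1) * (36 * n ^ 4) := by
    rw [← Subgroup.relIndex_mul_index (derivedPow_le (explicitN H) p)]
    refine mul_dvd_mul ((relIndex_derivedPow_dvd hp).trans (pow_dvd_pow p ?_)) hN
    exact Nat.succ_le_succ (Nat.le_of_dvd (Nat.pos_of_ne_zero hpos) hN)
  have h4 : (derivedPow ⊤ 4).relIndex (derivedPow (explicitN H) p) ∣ 4 := by
    have := derivedPow_normal (N := ⊤) 4
    have hle : derivedPow (explicitN H) p ≤ derivedPow ⊤ 2 :=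
      (derivedPow_le _ _).trans (inf_le_left.trans (derivedPow_top_mono (by norm_num)))
    refine (Subgroup.relIndex_dvd_of_le_right _ hle).trans (dvd_of_eq ?_)
    have := Subgroup.relIndex_mul_index (derivedPow_top_mono (by norm_num : 2 ∣ 4))
    rw [index_derivedPow_top, index_derivedPow_top] at this
    omega
  have hM : (derivedPow ⊤ 4).relIndex (derivedPow (explicitN H) p) *
      (derivedPow (explicitN H) p).index = (explicitM H p).index := by
    rw [← Subgroup.inf_relIndex_right]
    exact Subgroup.relIndex_mul_index inf_le_right
  rw [← hM]
  refine (mul_dvd_mul h4 hL).trans (dvd_of_eq ?_)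
  ring

/-! ### Equivariance of `π` -/

theorem modTwo_apply_of_mem_A {σ : MulAut F} (hσ : σ ∈ A) (w : F) : modTwo (σ w) = modTwo w := by
  induction hσ using Subgroup.closure_induction generalizing w with
  | one => rfl
  | mul σ τ _ _ h1 h2 => rw [MulAut.mul_apply, h1, h2]
  | inv σ _ h => rw [← h, MulAut.apply_inv_self]
  | mem σ hσ =>
    have key : ∀ v : V4, v ^ 2 = 1 := by decide
    have : modTwo.comp σ.toMonoidHom = modTwo := by
      refine FreeGroup.ext_hom _ _ fun i => ?_
      rcases hσ with rfl | rfl <;> fin_cases i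
      · exact congrArg modTwo alpha_x
      · refine (congrArg modTwo alpha_y).trans ?_
        rw [map_mul, map_pow, key, mul_one]; rfl
      · refine (congrArg modTwo beta_x).trans ?_
        rw [map_mul, map_pow, key, mul_one]; rfl
      · exact congrArg modTwo beta_y
    exact DFunLike.congr_fun this w

theorem apply_mem_Delta (σ : A) (d : Delta) : (σ : MulAut F) d ∈ Delta := by
  exact (modTwo_apply_of_mem_A σ.2 _).trans d.2

/-- The action of an element of `⟨α, β⟩` on `Δ`. -/
def actDelta (σ : A) : Delta →* Delta :=
  ((σ : MulAut F).toMonoidHom.comp Delta.subtype).codRestrict Delta (apply_mem_Delta σ)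

theorem coe_actDelta (σ : A) (d : Delta) : (actDelta σ d : F) = (σ : MulAut F) d := rfl

/-- `π` turns the action of `⟨α, β⟩` on `Δ` into conjugation, twisted by the endomorphism of
`⟨α, β⟩` with `α ↦ α⁻¹`, `β ↦ β⁻¹`. Up to inner automorphisms of `F₂` this endomorphism is the
conjugation by `x ↦ x⁻¹`, `y ↦ y`, so that it preserves every normal subgroup of `Aut F₂`
that contains the inner automorphisms. -/
theorem exists_piHom_actDelta (σ : A) : ∃ τ : A,
    (∀ d, piHom (actDelta σ d) = τ * piHom d * τ⁻¹) ∧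
      ((invX * (σ : MulAut F) * invX⁻¹ : MulAut F) : MulAut F ⧸ Inn) = (τ : MulAut F) := by
  obtain ⟨p1, p2, p3, p4, p5⟩ := piHom_values
  -- it suffices to compare `π ∘ σ` and a conjugate of `π` on the generators of `Δ`
  have gen (σ : A) (h1 : piHom (actDelta σ e1) = σ⁻¹ * piHom e1 * σ)
      (h2 : piHom (actDelta σ e2) = σ⁻¹ * piHom e2 * σ)
      (h3 : piHom (actDelta σ e3) = σ⁻¹ * piHom e3 * σ)
      (h4 : piHom (actDelta σ e4) = σ⁻¹ * piHom e4 * σ)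
      (h5 : piHom (actDelta σ e5) = σ⁻¹ * piHom e5 * σ) (d : Delta) :
      piHom (actDelta σ d) = σ⁻¹ * piHom d * σ := by
    have h : piHom.comp (actDelta σ) = (MulAut.conj σ⁻¹).toMonoidHom.comp piHom := by
      refine MonoidHom.eq_of_eqOn_dense closure_e ?_
      rintro _ (rfl | rfl | rfl | rfl | rfl) <;> simp [*]
    have := DFunLike.congr_fun h d
    simpa using this
  have ha (d : Delta) : piHom (actDelta a d) = a⁻¹ * piHom d * a := by
    have v (w : F) : (a : MulAut F) w = alpha w := rfl
    have q1 : actDelta a e1 = e1 := by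
      apply Subtype.ext; simp [coe_actDelta, v, e1, alpha_x]
    have q2 : actDelta a e2 = e2 := by
      apply Subtype.ext; simp [coe_actDelta, v, e2, alpha_x, alpha_y, pow_two, mul_assoc]
    have q3 : actDelta a e3 = e2 * e4 * e3 * e1 := by
      apply Subtype.ext
      simp [coe_actDelta, v, e1, e2, e3, e4, alpha_y, pow_two, mul_assoc]
    have q4 : actDelta a e4 = e4 := by
      apply Subtype.ext; simp [coe_actDelta, v, e4, alpha_x, alpha_y, pow_two, mul_assoc]
    have q5 : actDelta a e5 = e4 * e2 * e5 * e1 := by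
      apply Subtype.ext
      simp [coe_actDelta, v, e1, e2, e4, e5, alpha_x, alpha_y, pow_two, mul_assoc]
    apply gen <;> simp [q1, q2, q3, q4, q5, p1, p2, p3, p4, p5]
  have hb (d : Delta) : piHom (actDelta b d) = b⁻¹ * piHom d * b := by
    have v (w : F) : (b : MulAut F) w = beta w := rfl
    have q1 : actDelta b e1 = e5 * e1 * e3 := by
      apply Subtype.ext; simp [coe_actDelta, v, e1, e3, e5, beta_x, pow_two, mul_assoc]
    have q2 : actDelta b e2 = e2 := by
      apply Subtype.ext; simp [coe_actDelta, v, e2, beta_x, beta_y, pow_two, mul_assoc]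
    have q3 : actDelta b e3 = e3 := by
      apply Subtype.ext; simp [coe_actDelta, v, e3, beta_y]
    have q4 : actDelta b e4 = e5 * e4 * e3 := by
      apply Subtype.ext
      simp [coe_actDelta, v, e3, e4, e5, beta_x, beta_y, pow_two, mul_assoc]
    have q5 : actDelta b e5 = e5 := by
      apply Subtype.ext; simp [coe_actDelta, v, e5, beta_x, beta_y, pow_two, mul_assoc]
    apply gen <;> simp [q1, q2, q3, q4, q5, p1, p2, p3, p4, p5]
  obtain ⟨σ, hσ⟩ := σ
  induction hσ using Subgroup.closure_induction with
  | one =>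
    refine ⟨1, fun d => ?_, by simp⟩
    have : actDelta ⟨1, A.one_mem⟩ d = d := rfl
    rw [this]
    simp
  | mul σ σ' hσ hσ' h h' =>
    obtain ⟨τ, h1, h2⟩ := h
    obtain ⟨τ', h3, h4⟩ := h'
    refine ⟨τ * τ', fun d => ?_, ?_⟩
    · have : actDelta ⟨σ * σ', A.mul_mem hσ hσ'⟩ d = actDelta ⟨σ, hσ⟩ (actDelta ⟨σ', hσ'⟩ d) :=
        rfl
      rw [this, h1, h3]
      group
    · change ((invX * (σ * σ') * invX⁻¹ : MulAut F) : MulAut F ⧸ Inn) = (τ * τ' : MulAut F)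
      rw [show invX * (σ * σ') * invX⁻¹ = invX * σ * invX⁻¹ * (invX * σ' * invX⁻¹) by group]
      exact congrArg₂ (· * ·) h2 h4
  | inv σ hσ h =>
    obtain ⟨τ, h1, h2⟩ := h
    refine ⟨τ⁻¹, fun d => ?_, ?_⟩
    · have h3 := h1 (actDelta ⟨σ⁻¹, A.inv_mem hσ⟩ d)
      have : actDelta ⟨σ, hσ⟩ (actDelta ⟨σ⁻¹, A.inv_mem hσ⟩ d) = d :=
        Subtype.ext (MulAut.apply_inv_self _ σ _)
      rw [this] at h3
      rw [h3]
      group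
    · change ((invX * σ⁻¹ * invX⁻¹ : MulAut F) : MulAut F ⧸ Inn) = ((τ : MulAut F)⁻¹ : MulAut F)
      rw [show invX * σ⁻¹ * invX⁻¹ = (invX * σ * invX⁻¹)⁻¹ by group, QuotientGroup.mk_inv,
        QuotientGroup.mk_inv, ← h2]
  | mem σ hσ =>
    rcases hσ with rfl | rfl
    · refine ⟨a⁻¹, fun d => (ha d).trans (by simp), ?_⟩
      rw [invX_conj_alpha]; rfl
    · refine ⟨b⁻¹, fun d => (hb d).trans (by simp), ?_⟩
      have hinn : MulAut.conj (y⁻¹ * y⁻¹) ∈ Inn := ⟨_, rfl⟩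
      rw [invX_conj_beta, QuotientGroup.mk_mul, (QuotientGroup.eq_one_iff _).2 hinn, one_mul]
      rfl

theorem apply_commutator_of_mem_A {σ : MulAut F} (hσ : σ ∈ A) :
    σ (y * x * y⁻¹ * x⁻¹) = y * x * y⁻¹ * x⁻¹ := by
  have hle : A ≤ MulAction.stabilizer (MulAut F) (y * x * y⁻¹ * x⁻¹) := by
    refine (Subgroup.closure_le _).2 ?_
    rintro _ (rfl | rfl)
    · change alpha _ = _
      simp [alpha_x, alpha_y, pow_two, mul_assoc]
    · change beta _ = _
      simp [beta_x, beta_y, pow_two, mul_assoc]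
  exact hle hσ

end FreeTwo

namespace FreeTwo

open scoped commutatorElement

/-! ### Freeness of `⟨α, β⟩` -/

/-- Sanov: the two unipotent matrices generate a free group. The ping-pong sets are half-open
sectors of the plane, bounded by the diagonals and the axes. -/
theorem lift_matA_matB_injective :
    Function.Injective (FreeGroup.lift ![matA, matB] : F →* GL (Fin 2) ℤ) := by
  let X : Fin 2 → Set {v : Fin 2 → ℤ // v ≠ 0} :=
    ![{v | (0 < v.1 1 ∧ v.1 1 ≤ v.1 0) ∨ (v.1 1 < 0 ∧ v.1 0 ≤ v.1 1) ∨ (v.1 1 = 0 ∧ 0 < v.1 0)},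
      {v | (0 < v.1 0 ∧ v.1 0 < v.1 1) ∨ (v.1 0 < 0 ∧ v.1 1 < v.1 0) ∨ (v.1 0 = 0 ∧ 0 < v.1 1)}]
  let Y : Fin 2 → Set {v : Fin 2 → ℤ // v ≠ 0} :=
    ![{v | (0 < v.1 1 ∧ v.1 0 < -v.1 1) ∨ (v.1 1 < 0 ∧ -v.1 1 < v.1 0) ∨ (v.1 1 = 0 ∧ v.1 0 < 0)},
      {v | (0 < v.1 0 ∧ v.1 1 ≤ -v.1 0) ∨ (v.1 0 < 0 ∧ -v.1 0 ≤ v.1 1) ∨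
        (v.1 0 = 0 ∧ v.1 1 < 0)}]
  have hne (v : {v : Fin 2 → ℤ // v ≠ 0}) : v.1 0 ≠ 0 ∨ v.1 1 ≠ 0 := by
    by_contra! h
    exact v.2 (funext fun i => by fin_cases i; exacts [h.1, h.2])
  have vA (v : {v : Fin 2 → ℤ // v ≠ 0}) :
      (matA • v).1 0 = v.1 0 + 2 * v.1 1 ∧ (matA • v).1 1 = v.1 1 := by
    simp [matA, Matrix.mulVec, dotProduct]
  have vB (v : {v : Fin 2 → ℤ // v ≠ 0}) :
      (matB • v).1 0 = v.1 0 ∧ (matB • v).1 1 = 2 * v.1 0 + v.1 1 := by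
    simp [matB, Matrix.mulVec, dotProduct]
  have vA' (v : {v : Fin 2 → ℤ // v ≠ 0}) :
      (matA⁻¹ • v).1 0 = v.1 0 - 2 * v.1 1 ∧ (matA⁻¹ • v).1 1 = v.1 1 := by
    obtain ⟨h1, h2⟩ := vA (matA⁻¹ • v)
    rw [smul_inv_smul] at h1 h2
    omega
  have vB' (v : {v : Fin 2 → ℤ // v ≠ 0}) :
      (matB⁻¹ • v).1 0 = v.1 0 ∧ (matB⁻¹ • v).1 1 = v.1 1 - 2 * v.1 0 := by
    obtain ⟨h1, h2⟩ := vB (matB⁻¹ • v)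
    rw [smul_inv_smul] at h1 h2
    omega
  refine FreeGroup.injective_lift_of_ping_pong _ X Y ?_ ?_ ?_ ?_ ?_ ?_
  · intro i
    fin_cases i
    · exact ⟨⟨![1, 0], fun h => by simpa using congrFun h 0⟩, by simp [X]⟩
    · exact ⟨⟨![0, 1], fun h => by simpa using congrFun h 1⟩, by simp [X]⟩
  · intro i j hij
    refine Set.disjoint_left.2 fun v hv hv' => ?_
    fin_cases i <;> fin_cases j <;> simp [X] at hij hv hv' <;> omega
  · intro i j hij
    refine Set.disjoint_left.2 fun v hv hv' => ?_
    fin_cases i <;> fin_cases j <;> simp [Y] at hij hv hv' <;> omega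
  · intro i j
    refine Set.disjoint_left.2 fun v hv hv' => ?_
    fin_cases i <;> fin_cases j <;> simp [X, Y] at hv hv' <;> omega
  · rintro i _ ⟨v, hv, rfl⟩
    have h0 := hne v
    fin_cases i
    · have h1 := vA v
      change matA • v ∈ X 0
      generalize matA • v = w at h1 ⊢
      simp [X, Y] at hv ⊢
      omega
    · have h1 := vB v
      change matB • v ∈ X 1
      generalize matB • v = w at h1 ⊢
      simp [X, Y] at hv ⊢
      omega
  · rintro i _ ⟨v, hv, rfl⟩
    have h0 := hne v
    fin_cases i
    · have h1 := vA' v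
      change matA⁻¹ • v ∈ Y 0
      generalize matA⁻¹ • v = w at h1 ⊢
      simp [X, Y] at hv ⊢
      omega
    · have h1 := vB' v
      change matB⁻¹ • v ∈ Y 1
      generalize matB⁻¹ • v = w at h1 ⊢
      simp [X, Y] at hv ⊢
      omega

/-- The group `⟨α, β⟩` is free on `α` and `β`. -/
noncomputable def freeEquivA : F ≃* A :=
  MulEquiv.ofBijective (FreeGroup.lift ![a, b] : F →* A) <| by
    constructor
    · have h : (toGL.comp A.subtype).comp (FreeGroup.lift ![a, b]) =
          (FreeGroup.lift ![matA, matB] : F →* GL (Fin 2) ℤ) := by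
        refine FreeGroup.ext_hom _ _ fun i => ?_
        fin_cases i
        · change toGL (FreeGroup.lift ![a, b] (FreeGroup.of 0) : A) =
            FreeGroup.lift ![matA, matB] (FreeGroup.of 0)
          simp only [FreeGroup.lift_apply_of]
          exact toGL_alpha
        · change toGL (FreeGroup.lift ![a, b] (FreeGroup.of 1) : A) =
            FreeGroup.lift ![matA, matB] (FreeGroup.of 1)
          simp only [FreeGroup.lift_apply_of]
          exact toGL_beta
      have := lift_matA_matB_injective
      rw [← h] at this
      exact Function.Injective.of_comp (f := toGL.comp A.subtype) this
    · rw [← MonoidHom.range_eq_top, eq_top_iff]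
      rintro ⟨σ, hσ⟩ -
      have hle : A ≤ (FreeGroup.lift ![a, b] : F →* A).range.map A.subtype := by
        refine (Subgroup.closure_le _).2 ?_
        rintro _ (rfl | rfl)
        · exact ⟨a, ⟨x, by simp [x]⟩, rfl⟩
        · exact ⟨b, ⟨y, by simp [y]⟩, rfl⟩
      obtain ⟨τ, hτ, h⟩ := hle hσ
      have : τ = ⟨σ, hσ⟩ := Subtype.ext h
      rwa [← this]

theorem freeEquivA_x : freeEquivA x = a := by
  change FreeGroup.lift ![a, b] x = a
  simp [x]

theorem freeEquivA_y : freeEquivA y = b := by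
  change FreeGroup.lift ![a, b] y = b
  simp [y]

/-! ### The congruence subgroup -/

/-- The map `π`, followed by the identification of `⟨α, β⟩` with the free group. -/
noncomputable def piFree : Delta →* F := freeEquivA.symm.toMonoidHom.comp piHom

theorem piFree_e1 : piFree e1 = x := by
  change freeEquivA.symm (piHom e1) = x
  rw [piHom_values.1, MulEquiv.symm_apply_eq, freeEquivA_x]

theorem piFree_e3 : piFree e3 = y := by
  change freeEquivA.symm (piHom e3) = y
  rw [piHom_values.2.2.1, MulEquiv.symm_apply_eq, freeEquivA_y]

theorem piFree_surjective : Function.Surjective piFree := by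
  rw [← MonoidHom.range_eq_top, eq_top_iff]
  intro w _
  induction w using FreeGroup.induction_on with
  | C1 => exact one_mem _
  | of i => fin_cases i; exacts [⟨e1, piFree_e1⟩, ⟨e3, piFree_e3⟩]
  | inv_of i h => exact inv_mem (h trivial)
  | mul u v hu hv => exact mul_mem (hu trivial) (hv trivial)

theorem piFree_mem_derivedPow {N : Subgroup F} (hN : N ≤ Delta) {m : ℕ} {q : Delta}
    (hq : (q : F) ∈ derivedPow N m) :
    piFree q ∈ derivedPow ((N.subgroupOf Delta).map piFree) m := by
  have hle : derivedPow N m ≤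
      ((derivedPow ((N.subgroupOf Delta).map piFree) m).comap piFree).map Delta.subtype := by
    have hmem {g : F} (hg : g ∈ N) : piFree ⟨g, hN hg⟩ ∈ (N.subgroupOf Delta).map piFree :=
      ⟨⟨g, hN hg⟩, hg, rfl⟩
    refine sup_le (Subgroup.commutator_le.2 fun g hg h hh => ?_) ((Subgroup.closure_le _).2 ?_)
    · refine ⟨⁅(⟨g, hN hg⟩ : Delta), ⟨h, hN hh⟩⁆, ?_, rfl⟩
      rw [SetLike.mem_coe, Subgroup.mem_comap, map_commutatorElement]
      exact commutator_le_derivedPow _ m (Subgroup.commutator_mem_commutator (hmem hg) (hmem hh))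
    · rintro _ ⟨h, hh, rfl⟩
      refine ⟨⟨h, hN hh⟩ ^ m, ?_, rfl⟩
      rw [SetLike.mem_coe, Subgroup.mem_comap, map_pow]
      exact pow_mem_derivedPow (hmem hh) m
  obtain ⟨q', h1, h2⟩ := hle hq
  have : q' = q := Subtype.ext h2
  rwa [← this]

theorem piHom_mem_of_mem_explicitN {H : Subgroup (MulAut F)} {w : F} (hw : w ∈ explicitN H)
    (hw' : w ∈ Delta) : (piHom ⟨w, hw'⟩ : MulAut F) ∈ H :=
  (mem_preK.1 (Subgroup.normalCore_le _ (Subgroup.mem_inf.1 hw).2)).2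

theorem abMatrixMod_of_mem_congr {M : Subgroup F} {m : ℕ} (hM : M ≤ derivedPow ⊤ m)
    {σ : MulAut F} (hσ : σ ∈ congr M) : abMatrixMod m σ = 1 := by
  rw [← map_one (abMatrixMod m)]
  ext i j
  have h := (mem_derivedPow_top m _).1 (hM (QuotientGroup.eq.1 (hσ.2 (FreeGroup.of j)))) i
  rw [expSum_mul, expSum_inv, neg_add_eq_sub] at h
  rw [abMatrixMod_apply, abMatrixMod_apply]
  exact (ZMod.intCast_eq_intCast_iff_dvd_sub _ _ _).2 h

/-- The congruence subgroup `G(M)` lies in `H`. -/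
theorem congr_explicitM_le {H : Subgroup (MulAut F)} [H.Normal] (hInn : Inn ≤ H)
    (hfin : (explicitN H).FiniteIndex) {p : ℕ} (hp : p.Prime) (hp2 : p ≠ 2) :
    congr (explicitM H p) ≤ H := by
  intro σ hσ
  set N := explicitN H
  have hND : N ≤ Delta := explicitN_le_Delta H
  have hL := derivedPow_normal (N := N) p
  have htriv (w : F) : σ w * w⁻¹ ∈ derivedPow N p := by
    have h1 : (σ w)⁻¹ * w ∈ derivedPow N p :=
      (Subgroup.mem_inf.1 (QuotientGroup.eq.1 (hσ.2 w))).2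
    have h2 := hL.conj_mem _ (inv_mem h1) w
    rwa [show w * ((σ w)⁻¹ * w)⁻¹ * w⁻¹ = σ w * w⁻¹ by group] at h2
  obtain ⟨g, τ, rfl⟩ := exists_conj_mul_of_abMatrixMod_four
    (abMatrixMod_of_mem_congr inf_le_left hσ)
  -- `τ` fixes `[y, x]`, so that `g` commutes with it modulo `N' Nᵖ`
  obtain ⟨k, hk⟩ : ∃ k : ℤ, (g : F ⧸ N) = ((y * x * y⁻¹ * x⁻¹ : F) : F ⧸ N) ^ k := by
    refine mem_zpowers_of_commute_mod_derivedPow hp hp2 ?_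
    have := htriv (y * x * y⁻¹ * x⁻¹)
    rwa [MulAut.mul_apply, apply_commutator_of_mem_A τ.2, MulAut.conj_apply] at this
  have hν : (e2 : F) ^ (-k) * g ∈ N := by
    rw [zpow_neg]
    exact QuotientGroup.eq.1 hk.symm
  have hgD : g ∈ Delta := by
    have := mul_mem (Subgroup.zpow_mem _ e2.2 k) (hND hν)
    rwa [zpow_neg, mul_inv_cancel_left] at this
  have hπg : (piHom ⟨g, hgD⟩ : MulAut F) ∈ H := by
    have h1 : (⟨g, hgD⟩ : Delta) = e2 ^ k * ⟨_, hND hν⟩ := by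
      apply Subtype.ext
      simp
    rw [h1, map_mul, map_zpow, piHom_values.2.1, one_zpow, one_mul]
    exact piHom_mem_of_mem_explicitN hν _
  -- `π(g)` times the twist of `τ` is central modulo `R' Rᵖ`, where `R = π(N)`
  obtain ⟨ι, hι, hιτ⟩ := exists_piHom_actDelta τ
  let R : Subgroup F := (N.subgroupOf Delta).map piFree
  have hRn : R.Normal := Subgroup.Normal.map inferInstance _ piFree_surjective
  have hRf : Finite (F ⧸ R) := by
    have h1 : R.index ∣ (N.subgroupOf Delta).index :=
      Subgroup.index_map_dvd _ piFree_surjective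
    have h2 : (N.subgroupOf Delta).index ≠ 0 := Subgroup.FiniteIndex.index_ne_zero
    have : R.FiniteIndex := ⟨ne_zero_of_dvd_ne_zero h2 h1⟩
    infer_instance
  set h : F := freeEquivA.symm (piHom ⟨g, hgD⟩ * ι) with hh
  have hcentral (d : Delta) : h * piFree d * h⁻¹ * (piFree d)⁻¹ ∈ derivedPow R p := by
    have hq : ((⟨g, hgD⟩ * actDelta τ d * ⟨g, hgD⟩⁻¹ * d⁻¹ : Delta) : F) ∈ derivedPow N p := by
      have := htriv d
      rwa [MulAut.mul_apply, MulAut.conj_apply] at this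
    have hq' := piFree_mem_derivedPow hND hq
    have : piFree (⟨g, hgD⟩ * actDelta τ d * ⟨g, hgD⟩⁻¹ * d⁻¹) =
        h * piFree d * h⁻¹ * (piFree d)⁻¹ := by
      change freeEquivA.symm (piHom _) = h * freeEquivA.symm (piHom d) * h⁻¹ *
        (freeEquivA.symm (piHom d))⁻¹
      rw [hh, ← map_inv freeEquivA.symm, ← map_inv freeEquivA.symm, ← map_mul freeEquivA.symm,
        ← map_mul freeEquivA.symm, ← map_mul freeEquivA.symm]
      congr 1
      rw [map_mul, map_mul, map_mul, map_inv, map_inv, hι d]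
      group
    rwa [this] at hq'
  have hR : h ∈ R := by
    refine mem_of_central_mod_derivedPow hp.one_lt ?_ ?_
    · have := hcentral e1
      rwa [piFree_e1] at this
    · have := hcentral e3
      rwa [piFree_e3] at this
  have hιH : (ι : MulAut F) ∈ H := by
    obtain ⟨n, hn, hnh⟩ := hR
    have h1 : piHom n = piHom ⟨g, hgD⟩ * ι := freeEquivA.symm.injective hnh
    have h2 : (piHom n : MulAut F) ∈ H := piHom_mem_of_mem_explicitN hn n.2
    rw [h1, Subgroup.coe_mul] at h2
    exact (Subgroup.mul_mem_cancel_left _ hπg).1 h2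
  have hτH : (τ : MulAut F) ∈ H := by
    have h1 := hInn (QuotientGroup.eq.1 hιτ.symm)
    have h2 := (Subgroup.mul_mem_cancel_left _ (inv_mem hιH)).1 h1
    have h3 := Subgroup.Normal.conj_mem ‹_› _ h2 invX⁻¹
    rwa [show invX⁻¹ * (invX * (τ : MulAut F) * invX⁻¹) * invX⁻¹⁻¹ = τ by group] at h3
  exact mul_mem (hInn ⟨g, rfl⟩) hτH

end FreeTwo

theorem theorem2p9 (H : Subgroup (MulAut FreeTwo.F)) (hnormal : H.Normal)
    (hfin : H.FiniteIndex) (hInn : FreeTwo.Inn ≤ H) (hAut : H ≤ FreeTwo.AutPrime)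
    (n : ℕ) (hn : n = H.relIndex FreeTwo.AutPrime)
    (p : ℕ) (hp : p.Prime) (hpn : ¬ p ∣ 6 * n) :
    (FreeTwo.explicitM H p).Normal ∧
      (FreeTwo.explicitM H p).index ∣ 144 * n ^ 4 * p ^ (36 * n ^ 4 + 1) ∧
      FreeTwo.congr (FreeTwo.explicitM H p) ≤ H := by
  have hn0 : n ≠ 0 := by
    rw [hn]
    exact fun h => hfin.index_ne_zero (Nat.eq_zero_of_zero_dvd
      (h ▸ Subgroup.relIndex_dvd_index_of_normal H FreeTwo.AutPrime))
  have hp2 : p ≠ 2 := by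
    rintro rfl
    exact hpn (Dvd.dvd.mul_right (by norm_num) n)
  have hN : (FreeTwo.explicitN H).FiniteIndex :=
    ⟨ne_zero_of_dvd_ne_zero (by positivity) (hn ▸ FreeTwo.index_explicitN_dvd (H := H))⟩
  exact ⟨FreeTwo.explicitM_normal H p, FreeTwo.index_explicitM_dvd hn hn0 hp,
    FreeTwo.congr_explicitM_le hInn hN hp hp2⟩
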